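/- Let $\mathcal S=\mathcal S(\mathbb R^d)$ be the space of real Schwartz functions, $\mathcal S'$ its dual (real tempered distributions) with the Borel $\sigma$-algebra of the weak topology, and write $X(f)=\langle X,f\rangle$ for the coordinate process on $\mathcal S'$. Let $r$ be a symmetric probability measure on $[-c,c]$, $0<c<\infty$, with $r\{0\}=0$, put $\sigma^2=\int s^2\,dr(s)$ and, for $z\ge 1$, $$\psi_z(t)=z\int\big(e^{ist/\sqrt z}-1\big)\,dr(s),$$ the Lévy characteristic of the Poisson noise $F^z$ with activity $z$ and charges distributed as $s/\sqrt z$, $s\sim r$. Let $G\in L^1(\mathbb R^d,dx)$ be real-valued with $G\notin L^2(\mathbb R^d,dx)$, and for $f\in\mathcal S$ set $(\check G*f)(x)=\int G(y-x)f(y)\,dy$. Let $X^z=G*F^z$ be the convoluted Poisson noise (CPN) and $X^\sigma=G*F^\sigma$ the Gaussian convoluted noise, i.e. the random fields whose laws $P^{X^z}$, $P^{X^\sigma}$ on $\mathcal S'$ are the probability measures with characteristic functionals $$\mathbb E\big[e^{iX^z(f)}\big]=\exp\int_{\mathbb R^d}\psi_z\big((\check G*f)(x)\big)\,dx,\qquad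 \mathbb E\big[e^{iX^\sigma(f)}\big]=\exp\Big(-\frac{\sigma^2}{2}\int_{\mathbb R^d}(\check G*f)(x)^2\,dx\Big),\qquad f\in\mathcal S.$$ Let $\nu$ be a finite complex measure on $\mathbb R$ with $\nu\{0\}=0$ and $\nu(A)=\overline{\nu(-A)}$ for all measurable $A$, and let $v(t)=\int_{\mathbb R}\cos(\alpha t)\,d\nu(\alpha)$ be the (unrenormalized) trigonometric energy density. Let $\Lambda\subseteq\mathbb R^d$ be compact and $\beta>0$. For $X\in\mathcal S'$ given by a locally integrable function put $V_\Lambda(X)=\int_\Lambda v(X(x))\,dx$ (and $V_\Lambda(X)=0$ otherwise), and write $V^z_\Lambda$ for $V_\Lambda$ as a random variable on $(\mathcal S',P^{X^z})$. Then for every $z\ge 1$, $P^{X^z}$-almost every path is given by a locally integrable function, $V^z_\Lambda$ is $P^{X^z}$-almost everywhere equal to a measurable function, $\Xi^z_\Lambda=\mathbb E_{P^{X^z}}[e^{-\beta V^z_\Lambda}]\in(0,\infty)$, and $$P^{\bar X^z_\Lambda}=\frac{e^{-\beta V^z_\Lambda}}{\Xi^z_\Lambda}\,P^{X^z}$$ is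 a probability measure on $\mathcal S'$. Moreover $$\|V^z_\Lambda\|_{L^2(\mathcal S',P^{X^z})}\to 0\quad\text{as } z\to\infty,$$ and the interacting CPN $\bar X^z_\Lambda$ (the coordinate process under $P^{\bar X^z_\Lambda}$) converges in law to $X^\sigma$ as $z\to\infty$: for all $n$ and $f_1,\dots,f_n\in\mathcal S$ the random vectors $(\bar X^z_\Lambda(f_1),\dots,\bar X^z_\Lambda(f_n))$ converge in distribution to $(X^\sigma(f_1),\dots,X^\sigma(f_n))$. That is, the continuum limit is trivial (Gaussian). -/

import Mathlib

open MeasureTheory Filter Topology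
open scoped SchwartzMap BoundedContinuousFunction

noncomputable section

/-- The Euclidean space `ℝᵈ`. -/
abbrev Space (d : ℕ) : Type := EuclideanSpace ℝ (Fin d)

/-- The real tempered distributions on `ℝᵈ`: the continuous linear functionals on the space of
real Schwartz functions, with the weak topology (pointwise convergence on test functions). -/
abbrev TempDist (d : ℕ) : Type := 𝓢(Space d, ℝ) →Lₚₜ[ℝ] ℝ

/-- The Borel sigma-algebra of the weak topology. -/
instance (d : ℕ) : MeasurableSpace (TempDist d) := borel _

instance (d : ℕ) : BorelSpace (TempDist d) := ⟨rfl⟩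

/-- The Lévy characteristic `ψ(t) = i a t - (σ² / 2) t² + z ∫ (e^{ist} - 1) dr(s)` with
deterministic part `a`, Gaussian part `σ² = v`, activity `z` and Lévy measure `r`. -/
def levyChar (a v z : ℝ) (r : Measure ℝ) (t : ℝ) : ℂ :=
  Complex.I * a * t - (v / 2 : ℝ) * (t : ℂ) ^ 2
    + z * ∫ s, (Complex.exp (Complex.I * s * t) - 1) ∂r

/-- The Poisson characteristic `ψ_z` with activity `z` whose charges are those of `r`, scaled by
the factor `1 / √z`. -/
def scaledPoissonChar (r : Measure ℝ) (z : ℝ) : ℝ → ℂ :=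
  levyChar 0 0 z (r.map (fun s => s / Real.sqrt z))

/-- The Gaussian characteristic `t ↦ -(σ² / 2) t²`, where `v = σ²`. -/
def gaussianChar (v : ℝ) : ℝ → ℂ := levyChar 0 v 0 0

variable {d : ℕ}

/-- The functional `φ ↦ exp (∫ ψ(φ(x)) dx)`; on Schwartz functions it is the characteristic
functional of the generalized white noise with Lévy characteristic `ψ`. -/
def noiseCharFun (ψ : ℝ → ℂ) (φ : Space d → ℝ) : ℂ := Complex.exp (∫ x, ψ (φ x))

/-- The transpose of the convolution with `G`, i.e. `⟨G * η, f⟩ = ⟨η, adjConv G f⟩`. For a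
reflection invariant kernel this is `G * f`. -/
def adjConv (G f : Space d → ℝ) (x : Space d) : ℝ := ∫ y, G (y - x) * f y

/-- `P` is the law on the space of tempered distributions of the convoluted generalized white noise
`X = G * F`, where `F` has Lévy characteristic `ψ`: it is the (unique) probability measure for which
`E[exp (i X(f))] = C_F(G * f)` for all test functions `f`. -/
def IsConvolutedNoiseLaw (ψ : ℝ → ℂ) (G : Space d → ℝ) (P : Measure (TempDist d)) : Prop :=
  IsProbabilityMeasure P ∧
    ∀ f : 𝓢(Space d, ℝ),
      ∫ ω, Complex.exp (Complex.I * ((ω f : ℝ) : ℂ)) ∂P = noiseCharFun ψ (adjConv G f)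

/-- The tempered distribution `ω` is given by the locally integrable function `h`. -/
def IsGivenBy (ω : TempDist d) (h : Space d → ℝ) : Prop :=
  LocallyIntegrable h ∧
    ∀ f : 𝓢(Space d, ℝ), Integrable (fun x => h x * f x) ∧ ω f = ∫ x, h x * f x

open Classical in
/-- The potential `V_Λ = ⟨v(X), 1_Λ⟩ = ∫_Λ v(X(x)) dx`, as a function of the path `X = ω`. It is
defined for all paths which are (locally integrable) functions, and set to zero on the others. -/
def potential (v : ℝ → ℝ) (Λ : Set (Space d)) (ω : TempDist d) : ℝ :=
  if H : ∃ h : Space d → ℝ, IsGivenBy ω h then ∫ x in Λ, v (H.choose x) else 0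

theorem IsGivenBy.ae_eq {ω : TempDist d} {h k : Space d → ℝ} (hh : IsGivenBy ω h)
    (hk : IsGivenBy ω k) : h =ᵐ[volume] k := by
  refine ae_eq_of_integral_contDiff_smul_eq hh.1 hk.1 fun g hg hc => ?_
  have e1 := (hh.2 (hc.toSchwartzMap hg)).2
  have e2 := (hk.2 (hc.toSchwartzMap hg)).2
  rw [e1] at e2
  simpa [mul_comm] using e2

/-- The potential does not depend on the function which represents the path. -/
theorem potential_eq {ω : TempDist d} {h : Space d → ℝ} (hh : IsGivenBy ω h) (v : ℝ → ℝ)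
    (Λ : Set (Space d)) : potential v Λ ω = ∫ x in Λ, v (h x) := by
  have H : ∃ h : Space d → ℝ, IsGivenBy ω h := ⟨h, hh⟩
  rw [potential, dif_pos H]
  refine integral_congr_ae (ae_restrict_of_ae ?_)
  filter_upwards [H.choose_spec.ae_eq hh] with x hx
  rw [hx]

/-- The trigonometric energy density `v(t) = ∫ cos(α t) dν(α)` of a complex measure `ν`. This
integral is real if `ν(A)` is the complex conjugate of `ν(-A)` for all `A`; the real part only
serves to have a real-valued function. -/
def trigDensity (ν : ComplexMeasure ℝ) (t : ℝ) : ℝ :=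
  (VectorMeasure.integral ν (fun α => Real.cos (α * t)) (ContinuousLinearMap.lsmul ℝ ℝ)).re

/-- The partition function `Ξ_Λ = E_P[exp (-β V_Λ)]`. -/
def partitionFunction (β : ℝ) (V : TempDist d → ℝ) (P : Measure (TempDist d)) : ℝ :=
  ∫ ω, Real.exp (-β * V ω) ∂P

/-- The law `(exp (-β V_Λ) / Ξ_Λ) P` of the interacting random field. -/
def interactingLaw (β : ℝ) (V : TempDist d → ℝ) (P : Measure (TempDist d)) :
    Measure (TempDist d) :=
  P.withDensity fun ω => ENNReal.ofReal (Real.exp (-β * V ω) / partitionFunction β V P)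

/-- Convergence in law as `z → ∞` of the coordinate processes `X ↦ (X(f))_f` on the space of
tempered distributions: for all test functions `f₁, …, fₙ` the random vectors
`(X(f₁), …, X(fₙ))` converge in law. -/
def ConvergesInLaw (Q : ℝ → Measure (TempDist d)) (Q' : Measure (TempDist d)) : Prop :=
  ∀ (n : ℕ) (f : Fin n → 𝓢(Space d, ℝ)) (φ : (Fin n → ℝ) →ᵇ ℝ),
    Tendsto (fun z => ∫ ω, φ (fun i => ω (f i)) ∂(Q z)) atTop
      (𝓝 (∫ ω, φ (fun i => ω (f i)) ∂Q'))

end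

/-!
The theorem rests on one quantitative fact: for a kernel `G` which is integrable but not square
integrable, the two-point functions `E[cos (α (X(x) - X(y)))]` of the convoluted Poisson noise tend
to zero for `α ≠ 0` and almost all `x`, `y`. The field oscillates so wildly that the trigonometric
energy density averages out.

*The paths are functions.* For symmetric charges the characteristic functional of `X^z` is
`exp (-∫ poissonExponent r z (Ǧ * f))`, where `0 ≤ poissonExponent r z t ≤ √z E|s| |t|`.
Integrating `1 - E[cos (t X(f))]` against `dt / t²` gives `E|X(f)| ≤ √z E|s| ‖Ǧ * f‖₁`
(`lintegral_enorm_le_of_integral_cos`). Hence `X(φ)` is meaningful for `φ → δ_x`, since `Ǧ * φ`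
converges in `L¹` to a translate of the reflected kernel: the step functions `approxPath`, built
from finitely many mollifiers each, converge in `L¹` with respect to a weighted Lebesgue measure
times the law of the field (`exists_tendsto_approxPath`), and the limit represents almost every path
(`ae_isGivenBy`). That all test functions are dealt with outside of a single null set uses the
separability of the Schwartz space (`SchwartzMap.exists_countable_dense`).

*The two-point functions.* In the limit,
`E[cos (α (X(x) - X(y)))] = exp (-∫ poissonExponent r z (α (G (x - u) - G (y - u))) du)`
(`IsConvolutedNoiseLaw.exists_path`). As `z → ∞` the integrand tends to
`σ² α² / 2 · (G (x - u) - G (y - u))²`, so by Fatou's lemma the exponent diverges as soon as the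
difference of the two translates is not square integrable. This is so for almost all `x`, `y`
(`ae_lintegral_sub_sq_eq_top`): if `‖G (a + ·) - G‖₂` were bounded for `a` in a set of positive
measure, then `G` would differ by a square integrable function from an average of its translates,
which is bounded and integrable, so `G` would be square integrable.

*The potential.* By the addition theorem,
`E (∫_Λ cos (α X))² ≤ ∫_{Λ × Λ} E[cos (α (X(x) - X(y)))]`, and integrating the square roots over `α`
bounds `E|V_Λ|` by a quantity which vanishes as `z → ∞`
(`lintegral_enorm_integral_trigDensity_le`, `tendsto_integral_sqrt_pairAverage`). Since `V_Λ` is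
bounded uniformly in `z`, it vanishes in `L²` as well, and the Gibbs factor changes expectations of
bounded functions by `O(E|V_Λ|)` (`abs_integral_interactingLaw_sub_le`). The free fields
converge by Lévy's continuity theorem (`convergesInLaw_free`).
-/

/-! ### Separability of the Schwartz space -/

section Separability

variable {E : Type*} [NormedAddCommGroup E] [NormedSpace ℝ E]

/-- The `n`-th derivative of a Schwartz function, as an element of the space of continuous maps with
the compact-open topology. -/
noncomputable def SchwartzMap.iteratedFDerivContinuousMap (n : ℕ) (f : 𝓢(E, ℝ)) :
    C(E, E [×n]→L[ℝ] ℝ) :=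
  ⟨iteratedFDeriv ℝ n f, (f.smooth n).continuous_iteratedFDeriv le_rfl⟩

/-- On a set where the seminorm of index `(k + 1, n)` is bounded, locally uniform convergence of the
`n`-th derivatives implies convergence for the seminorm of index `(k, n)`. -/
theorem SchwartzMap.eventually_seminorm_sub_le [ProperSpace E] {k n : ℕ} {f : 𝓢(E, ℝ)}
    {u : ℕ → 𝓢(E, ℝ)} {C : ℝ} (hf : SchwartzMap.seminorm ℝ (k + 1) n f ≤ C)
    (hu : ∀ m, SchwartzMap.seminorm ℝ (k + 1) n (u m) ≤ C)
    (h : Tendsto (fun m => (u m).iteratedFDerivContinuousMap n) atTop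
      (𝓝 (f.iteratedFDerivContinuousMap n))) {ε : ℝ} (hε : 0 < ε) :
    ∀ᶠ m in atTop, SchwartzMap.seminorm ℝ k n (u m - f) ≤ ε := by
  have hC : 0 ≤ C := (apply_nonneg _ _).trans hf
  set R : ℝ := max 1 (2 * C / ε) with hR
  have hR1 : 1 ≤ R := le_max_left _ _
  have hR0 : 0 < R := by linarith
  have hRC : 2 * C ≤ ε * R := by
    have : 2 * C / ε ≤ R := le_max_right _ _
    rwa [div_le_iff₀ hε, mul_comm R] at this
  rw [ContinuousMap.tendsto_iff_forall_isCompact_tendstoUniformlyOn] at h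
  have h1 := h (Metric.closedBall 0 R) (isCompact_closedBall 0 R)
  rw [Metric.tendstoUniformlyOn_iff] at h1
  filter_upwards [h1 (ε / R ^ k) (by positivity)] with m hm
  refine SchwartzMap.seminorm_le_bound ℝ k n _ hε.le fun x => ?_
  -- outside the ball of radius `R`, the additional power of `‖x‖` compensates the bound `2 * C`
  by_cases hx : ‖x‖ ≤ R
  · have h2 := hm x (by simpa using hx)
    have h3 : ‖iteratedFDeriv ℝ n (u m - f : 𝓢(E, ℝ)) x‖ ≤ ε / R ^ k := by
      have : iteratedFDeriv ℝ n (u m - f : 𝓢(E, ℝ)) x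
          = iteratedFDeriv ℝ n (u m) x - iteratedFDeriv ℝ n f x := by
        have := iteratedFDeriv_sub_apply (𝕜 := ℝ) (i := n) (x := x)
          (((u m).smooth n).contDiffAt) ((f.smooth n).contDiffAt)
        rw [← this]; rfl
      rw [this, ← dist_eq_norm, dist_comm]
      exact h2.le
    calc ‖x‖ ^ k * ‖iteratedFDeriv ℝ n (u m - f : 𝓢(E, ℝ)) x‖ ≤ R ^ k * (ε / R ^ k) := by gcongr
      _ = ε := by field_simp
  · push Not at hx
    have h4 := SchwartzMap.le_seminorm ℝ (k + 1) n (u m - f) x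
    have h5 : SchwartzMap.seminorm ℝ (k + 1) n (u m - f) ≤ 2 * C := by
      refine (map_sub_le_add _ _ _).trans ?_
      linarith [hu m]
    have h6 : R * (‖x‖ ^ k * ‖iteratedFDeriv ℝ n (u m - f : 𝓢(E, ℝ)) x‖) ≤ ε * R := by
      calc _ ≤ ‖x‖ * (‖x‖ ^ k * ‖iteratedFDeriv ℝ n (u m - f : 𝓢(E, ℝ)) x‖) := by gcongr
        _ = ‖x‖ ^ (k + 1) * ‖iteratedFDeriv ℝ n (u m - f : 𝓢(E, ℝ)) x‖ := by ring
        _ ≤ _ := by linarith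
    rw [mul_comm ε] at h6
    exact le_of_mul_le_mul_left h6 hR0

/-- The Schwartz space is separable. On a set of functions with bounded seminorms, the convergence
for finitely many seminorms follows from the locally uniform convergence of finitely many
derivatives, and spaces of continuous maps with the compact-open topology are second countable. -/
theorem SchwartzMap.exists_countable_dense [FiniteDimensional ℝ E] :
    ∃ D : Set 𝓢(E, ℝ), D.Countable ∧ Dense D := by
  have : ProperSpace E := FiniteDimensional.proper ℝ E
  have hfd (n : ℕ) : SecondCountableTopology (E [×n]→L[ℝ] ℝ) := by
    have : FiniteDimensional ℝ (E [×n]→L[ℝ] ℝ) :=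
      FiniteDimensional.of_injective
        (ContinuousMultilinearMap.toMultilinearMapLinear :
          (E [×n]→L[ℝ] ℝ) →ₗ[ℝ] MultilinearMap ℝ (fun _ : Fin n => E) ℝ)
        ContinuousMultilinearMap.toMultilinearMap_injective
    have : ProperSpace (E [×n]→L[ℝ] ℝ) := FiniteDimensional.proper ℝ _
    infer_instance
  let Φ (K : ℕ) (f : 𝓢(E, ℝ)) : ∀ n : Fin (K + 1), C(E, E [×(n : ℕ)]→L[ℝ] ℝ) :=
    fun n => f.iteratedFDerivContinuousMap n
  let S (K j : ℕ) : Set 𝓢(E, ℝ) :=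
    {f | ∀ k ≤ K, ∀ n ≤ K, SchwartzMap.seminorm ℝ (k + 1) n f ≤ j}
  -- the image `Φ K '' S K j` is separable, as a subset of a second countable space
  have key (K j : ℕ) : ∃ D ⊆ S K j, D.Countable ∧ ∀ f ∈ S K j, Φ K f ∈ closure (Φ K '' D) := by
    obtain ⟨c, hc, hcd⟩ := TopologicalSpace.exists_countable_dense (Φ K '' S K j)
    have hch (y : Φ K '' S K j) : ∃ f ∈ S K j, Φ K f = y := y.2
    choose g hgS hg using hch
    refine ⟨g '' c, ?_, hc.image g, fun f hf => ?_⟩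
    · rintro _ ⟨y, -, rfl⟩
      exact hgS y
    · have h1 : (⟨Φ K f, f, hf, rfl⟩ : Φ K '' S K j) ∈ closure c := hcd _
      have h2 := image_closure_subset_closure_image continuous_subtype_val ⟨_, h1, rfl⟩
      have h3 : Subtype.val '' c = Φ K '' (g '' c) := by
        rw [Set.image_image]
        exact Set.image_congr fun y _ => (hg y).symm
      rwa [h3] at h2
  choose D hDS hDc hD using key
  refine ⟨⋃ K, ⋃ j, D K j, Set.countable_iUnion fun K => Set.countable_iUnion fun j => hDc K j,
    fun f => ?_⟩
  rw [mem_closure_iff_nhds_basis ((schwartz_withSeminorms ℝ E ℝ).hasBasis_ball)]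
  rintro ⟨s, r⟩ hr
  simp only at hr
  let K : ℕ := s.sup (fun i => max i.1 i.2)
  have hK1 : ∀ i ∈ s, i.1 ≤ K ∧ i.2 ≤ K := fun i hi =>
    ⟨(le_max_left _ _).trans (Finset.le_sup (f := fun i : ℕ × ℕ => max i.1 i.2) hi),
      (le_max_right _ _).trans (Finset.le_sup (f := fun i : ℕ × ℕ => max i.1 i.2) hi)⟩
  let B : ℝ := ∑ k ∈ Finset.range (K + 1), ∑ n ∈ Finset.range (K + 1),
    SchwartzMap.seminorm ℝ (k + 1) n f
  obtain ⟨j, hj⟩ := exists_nat_ge B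
  have hfS : f ∈ S K j := fun k hk n hn => by
    refine le_trans ?_ hj
    refine le_trans ?_ (Finset.single_le_sum (f := fun k => ∑ n ∈ Finset.range (K + 1),
      SchwartzMap.seminorm ℝ (k + 1) n f) (fun i _ => Finset.sum_nonneg fun _ _ => apply_nonneg _ _)
      (Finset.mem_range.2 (Nat.lt_succ_of_le hk)))
    exact Finset.single_le_sum (f := fun n => SchwartzMap.seminorm ℝ (k + 1) n f)
      (fun i _ => apply_nonneg _ _) (Finset.mem_range.2 (Nat.lt_succ_of_le hn))
  obtain ⟨y, hy, hlim⟩ := mem_closure_iff_seq_limit.1 (hD K j f hfS)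
  choose u huD hu using hy
  have hev : ∀ᶠ m in atTop, ∀ i ∈ s, SchwartzMap.seminorm ℝ i.1 i.2 (u m - f) ≤ r / 2 := by
    rw [Filter.eventually_all_finset]
    intro i hi
    refine SchwartzMap.eventually_seminorm_sub_le (hfS i.1 (hK1 i hi).1 i.2 (hK1 i hi).2)
      (fun m => hDS K j (huD m) i.1 (hK1 i hi).1 i.2 (hK1 i hi).2) ?_ (half_pos hr)
    have := (tendsto_pi_nhds.1 hlim) ⟨i.2, Nat.lt_succ_of_le (hK1 i hi).2⟩
    simpa only [← hu] using this
  obtain ⟨m, hm⟩ := hev.exists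
  refine ⟨u m, Set.mem_iUnion.2 ⟨K, Set.mem_iUnion.2 ⟨j, huD m⟩⟩, ?_⟩
  rw [Seminorm.mem_ball]
  refine Seminorm.finset_sup_apply_lt hr fun i hi => ?_
  exact (hm i hi).trans_lt (half_lt_self hr)

end Separability

/-! ### Functions integrable against a polynomial weight as tempered distributions -/

noncomputable section

/-- The finite measure `(1 + |x|)^(-d - 1) dx`, equivalent to the Lebesgue measure. -/
def weightMeasure (d : ℕ) : Measure (Space d) :=
  volume.withDensity fun x => ENNReal.ofReal ((1 + ‖x‖) ^ (d + 1))⁻¹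

variable {d : ℕ}

theorem measurable_weight :
    Measurable fun x : Space d => ENNReal.ofReal ((1 + ‖x‖) ^ (d + 1))⁻¹ := by
  fun_prop

instance : IsFiniteMeasure (weightMeasure d) := by
  refine ⟨?_⟩
  rw [weightMeasure, withDensity_apply _ MeasurableSet.univ, Measure.restrict_univ]
  have h := integrable_one_add_norm (E := Space d) (μ := volume) (r := (d + 1 : ℕ)) (by simp)
  refine lt_of_le_of_lt (lintegral_mono fun x => ?_) h.lintegral_lt_top
  rw [Real.rpow_neg (by positivity), Real.rpow_natCast]

theorem volume_absolutelyContinuous_weightMeasure :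
    (volume : Measure (Space d)) ≪ weightMeasure d := by
  refine withDensity_absolutelyContinuous' measurable_weight.aemeasurable (ae_of_all _ fun x => ?_)
  have : 0 < ((1 + ‖x‖) ^ (d + 1))⁻¹ := by positivity
  simpa using this

/-- The seminorm which controls Schwartz functions by the weight `(1 + |x|)^(-d - 1)`. -/
def weightSeminorm (d : ℕ) : Seminorm ℝ 𝓢(Space d, ℝ) :=
  (Finset.Iic (d + 1, 0)).sup (schwartzSeminormFamily ℝ (Space d) ℝ)

theorem abs_le_weightSeminorm (f : 𝓢(Space d, ℝ)) (x : Space d) :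
    |f x| ≤ 2 ^ (d + 1) * weightSeminorm d f * ((1 + ‖x‖) ^ (d + 1))⁻¹ := by
  have h := SchwartzMap.one_add_le_sup_seminorm_apply (𝕜 := ℝ) (m := (d + 1, 0)) (k := d + 1)
    (n := 0) le_rfl le_rfl f x
  rw [norm_iteratedFDeriv_zero, Real.norm_eq_abs] at h
  rw [← div_eq_mul_inv, le_div_iff₀ (by positivity), mul_comm]
  exact h

theorem lintegral_mul_schwartz_le (f : 𝓢(Space d, ℝ)) {g : Space d → ENNReal}
    (hg : AEMeasurable g) :
    ∫⁻ x, g x * ‖f x‖ₑ ≤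
      ENNReal.ofReal (2 ^ (d + 1) * weightSeminorm d f) * ∫⁻ x, g x ∂(weightMeasure d) := by
  rw [weightMeasure, lintegral_withDensity_eq_lintegral_mul₀ measurable_weight.aemeasurable hg,
    ← lintegral_const_mul' _ _ ENNReal.ofReal_ne_top]
  refine lintegral_mono fun x => ?_
  have h := abs_le_weightSeminorm f x
  have h0 : 0 ≤ 2 ^ (d + 1) * weightSeminorm d f := by positivity
  rw [← Real.norm_eq_abs] at h
  calc g x * ‖f x‖ₑ ≤ g x * ENNReal.ofReal (2 ^ (d + 1) * weightSeminorm d f *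
        ((1 + ‖x‖) ^ (d + 1))⁻¹) := by
        rw [← ofReal_norm]
        gcongr
    _ = _ := by
        rw [ENNReal.ofReal_mul h0, Pi.mul_apply]
        ring

theorem integrable_mul_schwartz {h : Space d → ℝ} (hh : Integrable h (weightMeasure d))
    (f : 𝓢(Space d, ℝ)) : Integrable fun x => h x * f x := by
  have hm : AEStronglyMeasurable h volume :=
    hh.1.mono_ac volume_absolutelyContinuous_weightMeasure
  refine ⟨hm.mul f.continuous.aestronglyMeasurable, ?_⟩
  rw [hasFiniteIntegral_iff_enorm]
  simp_rw [enorm_mul]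
  refine (lintegral_mul_schwartz_le f hm.enorm).trans_lt ?_
  exact ENNReal.mul_lt_top ENNReal.ofReal_lt_top hh.2

/-- The tempered distribution `f ↦ ∫ h f` given by a function integrable against the weight. -/
def weightedIntegralCLM {h : Space d → ℝ} (hh : Integrable h (weightMeasure d)) :
    𝓢(Space d, ℝ) →L[ℝ] ℝ :=
  SchwartzMap.mkCLMtoNormedSpace (fun f => ∫ x, h x * f x)
    (fun f g => by
      rw [← integral_add (integrable_mul_schwartz hh f) (integrable_mul_schwartz hh g)]
      simp [mul_add])
    (fun a f => by
      simp only [smul_apply, smul_eq_mul, RingHom.id_apply]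
      rw [← integral_const_mul]
      congr with x
      ring)
    ⟨Finset.Iic (d + 1, 0), 2 ^ (d + 1) * ∫ x, ‖h x‖ ∂(weightMeasure d), by positivity, fun f => by
      have hm : AEStronglyMeasurable h volume :=
        hh.1.mono_ac volume_absolutelyContinuous_weightMeasure
      have h1 := lintegral_mul_schwartz_le f hm.enorm
      have h2 : ‖∫ x, h x * f x‖ₑ ≤ _ :=
        (enorm_integral_le_lintegral_enorm _).trans (by simpa only [enorm_mul] using h1)
      rw [← toReal_enorm]
      refine (ENNReal.toReal_mono
        (ENNReal.mul_ne_top ENNReal.ofReal_ne_top hh.2.ne) h2).trans ?_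
      rw [ENNReal.toReal_mul, ENNReal.toReal_ofReal (by positivity),
        integral_norm_eq_lintegral_enorm hh.1]
      exact le_of_eq (by rw [weightSeminorm]; ring)⟩

theorem locallyIntegrable_of_integrable_weightMeasure {h : Space d → ℝ}
    (hh : Integrable h (weightMeasure d)) : LocallyIntegrable h := by
  refine (locallyIntegrable_iff).2 fun K hK => ?_
  have hm : AEStronglyMeasurable h volume :=
    hh.1.mono_ac volume_absolutelyContinuous_weightMeasure
  obtain ⟨R, hR⟩ := hK.isBounded.exists_norm_le
  have hi := (integrable_withDensity_iff_integrable_smul' (μ := volume) measurable_weight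
    (ae_of_all _ fun x => ENNReal.ofReal_lt_top) (g := h)).1 hh
  have h2 : IntegrableOn (fun x => (1 + |R|) ^ (d + 1) *
      ‖(ENNReal.ofReal ((1 + ‖x‖) ^ (d + 1))⁻¹).toReal • h x‖) K :=
    (hi.norm.const_mul _).integrableOn
  refine Integrable.mono h2 hm.restrict ?_
  filter_upwards [ae_restrict_mem hK.measurableSet] with x hx
  rw [ENNReal.toReal_ofReal (by positivity), norm_mul, norm_norm, norm_smul]
  have hxR : ‖x‖ ≤ |R| := (hR x hx).trans (le_abs_self R)
  have h3 : 1 ≤ ‖(1 + |R|) ^ (d + 1)‖ * ‖((1 + ‖x‖) ^ (d + 1))⁻¹‖ := by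
    rw [Real.norm_of_nonneg (by positivity), Real.norm_of_nonneg (by positivity),
      ← div_eq_mul_inv, one_le_div (by positivity)]
    gcongr
  rw [← mul_assoc]
  exact le_mul_of_one_le_left (norm_nonneg _) h3

/-- A tempered distribution which agrees on a dense set of test functions with the integral against
a function `h`, integrable with the polynomial weight, is given by `h`. -/
theorem isGivenBy_of_dense {D : Set 𝓢(Space d, ℝ)} (hD : Dense D) {ω : TempDist d}
    {h : Space d → ℝ} (hh : Integrable h (weightMeasure d))
    (hω : ∀ f ∈ D, ω f = ∫ x, h x * f x) : IsGivenBy ω h := by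
  refine ⟨locallyIntegrable_of_integrable_weightMeasure hh, fun f =>
    ⟨integrable_mul_schwartz hh f, ?_⟩⟩
  have h1 : Continuous fun f : 𝓢(Space d, ℝ) => ω f := map_continuous ω
  have h2 : Continuous fun f : 𝓢(Space d, ℝ) => ∫ x, h x * f x :=
    (weightedIntegralCLM hh).continuous
  exact congrFun (h1.ext_on hD h2 fun f hf => hω f hf) f

theorem measurable_eval (f : 𝓢(Space d, ℝ)) : Measurable fun ω : TempDist d => ω f := by
  have : Continuous fun ω : TempDist d => ω f := by fun_prop
  exact this.measurable

end

/-! ### The exponent of the scaled Poisson noise -/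

noncomputable section

/-- The exponent `z ∫ (1 - cos (s t / √z)) dr(s)`; for a symmetric law `r` of the charges it is
the negative of the scaled Poisson characteristic. -/
def poissonExponent (r : Measure ℝ) (z t : ℝ) : ℝ :=
  z * ∫ s, (1 - Real.cos (s * t / Real.sqrt z)) ∂r

theorem one_sub_cos_eq (x : ℝ) : 1 - Real.cos x = x ^ 2 / 2 * Real.sinc (x / 2) ^ 2 := by
  rcases eq_or_ne x 0 with rfl | hx
  · simp
  · rw [Real.sinc_of_ne_zero (by positivity), div_pow, ← mul_div_assoc]
    have h : Real.cos x = 1 - 2 * Real.sin (x / 2) ^ 2 := by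
      have := Real.cos_two_mul (x / 2)
      rw [mul_div_cancel₀ x two_ne_zero] at this
      rw [this, Real.cos_sq']
      ring
    rw [h]
    field_simp
    ring

theorem one_sub_cos_nonneg (x : ℝ) : 0 ≤ 1 - Real.cos x := sub_nonneg.2 (Real.cos_le_one x)

theorem one_sub_cos_le_sq (x : ℝ) : 1 - Real.cos x ≤ x ^ 2 / 2 := by
  linarith [Real.one_sub_sq_div_two_le_cos (x := x)]

section

variable {r : Measure ℝ}

theorem poissonExponent_nonneg {z : ℝ} (hz : 0 ≤ z) (t : ℝ) : 0 ≤ poissonExponent r z t :=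
  mul_nonneg hz (integral_nonneg fun _ => one_sub_cos_nonneg _)

theorem poissonExponent_zero (z : ℝ) : poissonExponent r z 0 = 0 := by simp [poissonExponent]

theorem measurable_poissonExponent [SFinite r] (z : ℝ) : Measurable (poissonExponent r z) := by
  have h : Measurable fun p : ℝ × ℝ => 1 - Real.cos (p.2 * p.1 / Real.sqrt z) := by fun_prop
  exact (h.stronglyMeasurable.integral_prod_right' (ν := r)).measurable.const_mul z

theorem integrable_one_sub_cos [IsFiniteMeasure r] (a : ℝ) :
    Integrable (fun s => 1 - Real.cos (s * a)) r := by
  refine Integrable.of_bound (by fun_prop : Measurable _).aestronglyMeasurable 2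
    (ae_of_all _ fun s => ?_)
  rw [Real.norm_of_nonneg (one_sub_cos_nonneg _)]
  linarith [Real.neg_one_le_cos (s * a)]

theorem abs_poissonExponent_sub_le [IsFiniteMeasure r] (hr : Integrable (fun s => |s|) r) {z : ℝ}
    (hz : 0 < z) (t t' : ℝ) : |poissonExponent r z t - poissonExponent r z t'| ≤
      Real.sqrt z * (∫ s, |s| ∂r) * |t - t'| := by
  have hi (a : ℝ) : Integrable (fun s => 1 - Real.cos (s * a / Real.sqrt z)) r := by
    simpa only [mul_div_assoc] using integrable_one_sub_cos (a / Real.sqrt z)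
  have h1 : |∫ s, ((1 - Real.cos (s * t / Real.sqrt z)) - (1 - Real.cos (s * t' / Real.sqrt z))) ∂r|
      ≤ ∫ s, |s| * (|t - t'| / Real.sqrt z) ∂r := by
    rw [← Real.norm_eq_abs]
    refine norm_integral_le_of_norm_le (hr.mul_const _) (ae_of_all _ fun s => ?_)
    rw [sub_sub_sub_cancel_left, Real.norm_eq_abs]
    refine (Real.abs_cos_sub_cos_le _ _).trans (le_of_eq ?_)
    rw [← sub_div, ← mul_sub, abs_div, abs_mul, abs_of_nonneg (Real.sqrt_nonneg z), abs_sub_comm,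
      mul_div_assoc]
  rw [integral_mul_const] at h1
  rw [poissonExponent, poissonExponent, ← mul_sub, ← integral_sub (hi t) (hi t'), abs_mul,
    abs_of_pos hz]
  refine (mul_le_mul_of_nonneg_left h1 hz.le).trans (le_of_eq ?_)
  have h3 : Real.sqrt z ≠ 0 := (Real.sqrt_pos.2 hz).ne'
  field_simp
  rw [Real.sq_sqrt hz.le]
  ring

theorem poissonExponent_le_abs [IsFiniteMeasure r] (hr : Integrable (fun s => |s|) r) {z : ℝ}
    (hz : 0 < z) (t : ℝ) : poissonExponent r z t ≤ Real.sqrt z * (∫ s, |s| ∂r) * |t| := by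
  simpa [poissonExponent_zero] using (le_abs_self _).trans (abs_poissonExponent_sub_le hr hz t 0)

theorem poissonExponent_le_sq [IsFiniteMeasure r] (hr : Integrable (fun s => s ^ 2) r) {z : ℝ}
    (hz : 0 < z) (t : ℝ) : poissonExponent r z t ≤ (∫ s, s ^ 2 ∂r) / 2 * t ^ 2 := by
  have h1 : ∫ s, (1 - Real.cos (s * t / Real.sqrt z)) ∂r ≤ ∫ s, s ^ 2 * (t ^ 2 / (2 * z)) ∂r := by
    refine integral_mono ?_ (hr.mul_const _) fun s => ?_
    · simpa only [mul_div_assoc] using integrable_one_sub_cos (t / Real.sqrt z)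
    · refine (one_sub_cos_le_sq _).trans (le_of_eq ?_)
      rw [div_pow, Real.sq_sqrt hz.le, mul_pow]
      field_simp
  rw [integral_mul_const] at h1
  refine (mul_le_mul_of_nonneg_left h1 hz.le).trans (le_of_eq ?_)
  field_simp

theorem tendsto_mul_one_sub_cos (a : ℝ) :
    Tendsto (fun z : ℝ => z * (1 - Real.cos (a / Real.sqrt z))) atTop (𝓝 (a ^ 2 / 2)) := by
  have h1 : Tendsto (fun z : ℝ => a ^ 2 / 2 * Real.sinc (a / Real.sqrt z / 2) ^ 2) atTop
      (𝓝 (a ^ 2 / 2 * Real.sinc (0 / 2) ^ 2)) := by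
    have h2 : Tendsto (fun z : ℝ => a / Real.sqrt z) atTop (𝓝 0) :=
      Real.tendsto_sqrt_atTop.const_div_atTop a
    exact ((((Real.continuous_sinc.comp (continuous_id.div_const 2)).tendsto 0).comp h2).pow
      2).const_mul _
  rw [zero_div, Real.sinc_zero, one_pow, mul_one] at h1
  refine h1.congr' ?_
  filter_upwards [eventually_gt_atTop 0] with z hz
  rw [one_sub_cos_eq, div_pow a, Real.sq_sqrt hz.le]
  field_simp

theorem tendsto_poissonExponent [IsFiniteMeasure r] (hr : Integrable (fun s => s ^ 2) r) (t : ℝ) :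
    Tendsto (fun z => poissonExponent r z t) atTop (𝓝 ((∫ s, s ^ 2 ∂r) / 2 * t ^ 2)) := by
  have h : Tendsto (fun z => ∫ s, z * (1 - Real.cos (s * t / Real.sqrt z)) ∂r) atTop
      (𝓝 (∫ s, (s * t) ^ 2 / 2 ∂r)) := by
    refine tendsto_integral_filter_of_dominated_convergence (fun s => s ^ 2 * (t ^ 2 / 2))
      (Eventually.of_forall fun z => (by fun_prop : Measurable _).aestronglyMeasurable) ?_
      (hr.mul_const _) (ae_of_all _ fun s => tendsto_mul_one_sub_cos (s * t))
    filter_upwards [eventually_gt_atTop 0] with z hz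
    refine ae_of_all _ fun s => ?_
    rw [Real.norm_of_nonneg (mul_nonneg hz.le (one_sub_cos_nonneg _))]
    refine (mul_le_mul_of_nonneg_left (one_sub_cos_le_sq _) hz.le).trans (le_of_eq ?_)
    rw [div_pow, Real.sq_sqrt hz.le]
    field_simp
  have e : ∫ s, (s * t) ^ 2 / 2 ∂r = (∫ s, s ^ 2 ∂r) / 2 * t ^ 2 := by
    simp_rw [mul_pow, mul_div_assoc]
    rw [integral_mul_const]
    ring
  rw [e] at h
  exact h.congr fun z => by rw [poissonExponent, integral_const_mul]

theorem scaledPoissonChar_eq [IsFiniteMeasure r] (hsymm : r.map (fun s => -s) = r) (z t : ℝ) :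
    scaledPoissonChar r z t = ((-poissonExponent r z t : ℝ) : ℂ) := by
  have h1 : ∫ s, (Complex.exp (Complex.I * s * t) - 1) ∂(r.map fun s => s / Real.sqrt z) =
      ∫ s : ℝ, (Complex.exp (Complex.I * (s / Real.sqrt z : ℝ) * t) - 1) ∂r := by
    rw [integral_map (by fun_prop)]
    exact (by fun_prop : Continuous _).aestronglyMeasurable
  have h2 (s : ℝ) : Complex.exp (Complex.I * (s / Real.sqrt z : ℝ) * t) - 1 =
      ((-(1 - Real.cos (s * (t / Real.sqrt z))) : ℝ) : ℂ) +
        ((Real.sin (s * (t / Real.sqrt z)) : ℝ) : ℂ) * Complex.I := by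
    have : Complex.I * (s / Real.sqrt z : ℝ) * t =
        ((s * (t / Real.sqrt z) : ℝ) : ℂ) * Complex.I := by
      push_cast
      ring
    rw [this, Complex.exp_mul_I]
    push_cast
    ring
  have hi : Integrable (fun s => Real.sin (s * (t / Real.sqrt z))) r :=
    Integrable.of_bound (by fun_prop : Measurable _).aestronglyMeasurable 1
      (ae_of_all _ fun s => Real.abs_sin_le_one _)
  -- the symmetry of the charges removes the imaginary part
  have h3 : ∫ s, Real.sin (s * (t / Real.sqrt z)) ∂r = 0 := by
    have h4 : ∫ s, Real.sin (s * (t / Real.sqrt z)) ∂r =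
        ∫ s, Real.sin (-s * (t / Real.sqrt z)) ∂r := by
      conv_lhs => rw [← hsymm]
      rw [integral_map (by fun_prop) (by fun_prop : Measurable _).aestronglyMeasurable]
    simp_rw [neg_mul, Real.sin_neg] at h4
    rw [integral_neg] at h4
    linarith
  rw [scaledPoissonChar, levyChar, h1]
  simp_rw [h2]
  rw [integral_add (integrable_one_sub_cos _).neg.ofReal (hi.ofReal.mul_const _),
    integral_mul_const, integral_complex_ofReal, integral_complex_ofReal, h3, poissonExponent,
    integral_neg]
  simp [mul_div_assoc]

theorem gaussianChar_eq (v t : ℝ) : gaussianChar v t = ((-(v / 2 * t ^ 2) : ℝ) : ℂ) := by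
  simp [gaussianChar, levyChar]

end

/-! ### First absolute moments from characteristic functions -/

/-- The constant `∫ (1 - cos t) / t² dt`. Its value `π` is irrelevant; it only has to be positive
and finite. -/
def absMomentConst : ENNReal := ∫⁻ t : ℝ, ENNReal.ofReal ((1 - Real.cos t) / t ^ 2)

theorem absMomentConst_ne_top : absMomentConst ≠ ⊤ := by
  refine ne_of_lt (lt_of_le_of_lt (lintegral_mono fun t => ENNReal.ofReal_le_ofReal ?_)
    (integrable_inv_one_add_sq.const_mul 4).lintegral_lt_top)
  rw [← div_eq_mul_inv]
  rcases eq_or_ne t 0 with rfl | ht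
  · simp
  · rw [div_le_div_iff₀ (by positivity) (by positivity)]
    nlinarith [one_sub_cos_le_sq t, Real.neg_one_le_cos t, sq_nonneg t]

theorem absMomentConst_ne_zero : absMomentConst ≠ 0 := by
  intro h
  rw [absMomentConst, lintegral_eq_zero_iff (by fun_prop)] at h
  have h1 : volume (Set.Ioo (0 : ℝ) 1) = 0 := by
    refine measure_mono_null (fun t ht => ?_) h
    have hc : Real.cos t < 1 := by
      rw [← Real.cos_zero]
      exact Real.cos_lt_cos_of_nonneg_of_le_pi le_rfl (by linarith [ht.2, Real.pi_gt_three]) ht.1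
    have : 0 < (1 - Real.cos t) / t ^ 2 := div_pos (by linarith) (pow_pos ht.1 2)
    simpa using this
  simp at h1

theorem lintegral_one_sub_cos_mul (a : ℝ) :
    ∫⁻ t : ℝ, ENNReal.ofReal ((1 - Real.cos (a * t)) / t ^ 2) = ‖a‖ₑ * absMomentConst := by
  rcases eq_or_ne a 0 with rfl | ha
  · simp
  have h1 (t : ℝ) : ENNReal.ofReal ((1 - Real.cos (a * t)) / t ^ 2) =
      ENNReal.ofReal (a ^ 2) * ENNReal.ofReal ((1 - Real.cos (a * t)) / (a * t) ^ 2) := by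
    rw [← ENNReal.ofReal_mul (sq_nonneg a)]
    congr 1
    rcases eq_or_ne t 0 with rfl | ht
    · simp
    · field_simp
  simp_rw [h1]
  have hm : Measurable fun t : ℝ => ENNReal.ofReal ((1 - Real.cos t) / t ^ 2) := by fun_prop
  rw [lintegral_const_mul' _ _ ENNReal.ofReal_ne_top,
    ← lintegral_map (f := fun t : ℝ => ENNReal.ofReal ((1 - Real.cos t) / t ^ 2)) hm
      (measurable_const_mul a), Real.map_volume_mul_left ha, lintegral_smul_measure, smul_eq_mul,
    ← mul_assoc, ← ENNReal.ofReal_mul (sq_nonneg a), absMomentConst, Real.enorm_eq_ofReal_abs]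
  congr 2
  rw [abs_inv, ← sq_abs]
  have : |a| ≠ 0 := abs_ne_zero.2 ha
  field_simp

/-- If `cos (t X)` has expectation `exp (-∫ ψ(t g(u)) du)`, where `ψ` is the exponent of the scaled
Poisson noise, then the first absolute moment of `X` is at most `√z ∫ |s| dr(s) ∫ |g|`. This
follows by integrating `1 - E[cos (t X)] ≤ ∫ ψ(t g(u)) du` against `dt / t²`. -/
theorem lintegral_enorm_le_of_integral_cos {Ω α : Type*} [MeasurableSpace Ω] [MeasurableSpace α]
    {P : Measure Ω} [IsProbabilityMeasure P] {μ : Measure α} [SFinite μ] {r : Measure ℝ}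
    [IsProbabilityMeasure r] (hr : Integrable (fun s => |s|) r) {z : ℝ} (hz : 0 < z)
    {X : Ω → ℝ} (hX : Measurable X) {g : α → ℝ} (hg : Measurable g) (hgi : Integrable g μ)
    (h : ∀ t : ℝ, ∫ ω, Real.cos (t * X ω) ∂P =
      Real.exp (-∫ u, poissonExponent r z (t * g u) ∂μ)) :
    ∫⁻ ω, ‖X ω‖ₑ ∂P ≤ ENNReal.ofReal (Real.sqrt z * ∫ s, |s| ∂r) * ∫⁻ u, ‖g u‖ₑ ∂μ := by
  have hz' : 0 < Real.sqrt z := Real.sqrt_pos.2 hz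
  have hψi (t : ℝ) : Integrable (fun u => poissonExponent r z (t * g u)) μ := by
    refine Integrable.mono' ((hgi.norm.const_mul (Real.sqrt z * (∫ s, |s| ∂r) * |t|)))
      ((measurable_poissonExponent z).comp (hg.const_mul t)).aestronglyMeasurable
      (ae_of_all _ fun u => ?_)
    rw [Real.norm_of_nonneg (poissonExponent_nonneg hz.le _)]
    refine (poissonExponent_le_abs hr hz _).trans (le_of_eq ?_)
    rw [abs_mul, Real.norm_eq_abs]
    ring
  have hXi (t : ℝ) : Integrable (fun ω => 1 - Real.cos (t * X ω)) P := by
    refine Integrable.of_bound (by fun_prop : Measurable _).aestronglyMeasurable 2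
      (ae_of_all _ fun s => ?_)
    rw [Real.norm_of_nonneg (one_sub_cos_nonneg _)]
    linarith [Real.neg_one_le_cos (t * X s)]
  have hc (t : ℝ) : Integrable (fun ω => Real.cos (t * X ω)) P :=
    Integrable.of_bound (by fun_prop : Measurable _).aestronglyMeasurable 1
      (ae_of_all _ fun s => Real.abs_cos_le_one _)
  -- for fixed `t`, from `1 - exp (-x) ≤ x`
  have h1 (t : ℝ) : ∫⁻ ω, ENNReal.ofReal ((1 - Real.cos (X ω * t)) / t ^ 2) ∂P ≤
      ∫⁻ u, ∫⁻ s, ENNReal.ofReal z * ENNReal.ofReal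
        ((1 - Real.cos (s * g u / Real.sqrt z * t)) / t ^ 2) ∂r ∂μ := by
    have h2 : ENNReal.ofReal (∫ ω, (1 - Real.cos (t * X ω)) ∂P) ≤
        ∫⁻ u, ENNReal.ofReal (poissonExponent r z (t * g u)) ∂μ := by
      rw [← ofReal_integral_eq_lintegral_ofReal (hψi t)
        (ae_of_all _ fun u => poissonExponent_nonneg hz.le _)]
      refine ENNReal.ofReal_le_ofReal ?_
      rw [integral_sub (integrable_const _) (hc t), h t]
      simp only [integral_const, probReal_univ, smul_eq_mul, mul_one]
      linarith [Real.add_one_le_exp (-∫ u, poissonExponent r z (t * g u) ∂μ)]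
    have h3 (u : α) : ENNReal.ofReal (poissonExponent r z (t * g u)) =
        ∫⁻ s, ENNReal.ofReal z * ENNReal.ofReal (1 - Real.cos (s * g u / Real.sqrt z * t)) ∂r := by
      rw [poissonExponent, ENNReal.ofReal_mul hz.le, ofReal_integral_eq_lintegral_ofReal,
        lintegral_const_mul' _ _ ENNReal.ofReal_ne_top]
      · congr 1
        refine lintegral_congr fun s => ?_
        congr 3
        ring
      · simpa only [mul_div_assoc] using integrable_one_sub_cos (t * g u / Real.sqrt z)
      · exact ae_of_all _ fun s => one_sub_cos_nonneg _
    have h4 (y : ℝ) : ENNReal.ofReal (y / t ^ 2) = ENNReal.ofReal (t ^ 2)⁻¹ * ENNReal.ofReal y := by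
      rw [← ENNReal.ofReal_mul (by positivity), div_eq_mul_inv, mul_comm]
    simp_rw [h4, mul_left_comm (ENNReal.ofReal z)]
    simp_rw [lintegral_const_mul' _ _ (ENNReal.ofReal_ne_top (r := (t ^ 2)⁻¹))]
    refine mul_le_mul_right ?_ _
    simp_rw [← h3]
    refine le_trans (le_of_eq ?_) h2
    rw [ofReal_integral_eq_lintegral_ofReal (hXi t) (ae_of_all _ fun _ => one_sub_cos_nonneg _)]
    simp_rw [mul_comm t]
  -- Tonelli's theorem, in order to perform the integral over `t` first on both sides
  have hcore : absMomentConst * ∫⁻ ω, ‖X ω‖ₑ ∂P ≤ absMomentConst *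
      (ENNReal.ofReal (Real.sqrt z * ∫ s, |s| ∂r) * ∫⁻ u, ‖g u‖ₑ ∂μ) := by
    calc absMomentConst * ∫⁻ ω, ‖X ω‖ₑ ∂P
        = ∫⁻ ω, (∫⁻ t : ℝ, ENNReal.ofReal ((1 - Real.cos (X ω * t)) / t ^ 2)) ∂P := by
          simp_rw [lintegral_one_sub_cos_mul, mul_comm _ absMomentConst]
          rw [lintegral_const_mul' _ _ absMomentConst_ne_top]
      _ = ∫⁻ t : ℝ, ∫⁻ ω, ENNReal.ofReal ((1 - Real.cos (X ω * t)) / t ^ 2) ∂P := by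
          refine lintegral_lintegral_swap (Measurable.aemeasurable ?_)
          simp only [Function.uncurry_def]
          fun_prop
      _ ≤ ∫⁻ t : ℝ, ∫⁻ u, ∫⁻ s, ENNReal.ofReal z * ENNReal.ofReal
            ((1 - Real.cos (s * g u / Real.sqrt z * t)) / t ^ 2) ∂r ∂μ := lintegral_mono h1
      _ = ∫⁻ u, (∫⁻ t : ℝ, ∫⁻ s, ENNReal.ofReal z * ENNReal.ofReal
            ((1 - Real.cos (s * g u / Real.sqrt z * t)) / t ^ 2) ∂r) ∂μ := by
          refine lintegral_lintegral_swap (Measurable.aemeasurable ?_)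
          simp only [Function.uncurry_def]
          refine Measurable.lintegral_prod_right' (f := fun p : (ℝ × α) × ℝ => ENNReal.ofReal z *
            ENNReal.ofReal ((1 - Real.cos (p.2 * g p.1.2 / Real.sqrt z * p.1.1)) / p.1.1 ^ 2)) ?_
          fun_prop
      _ = ∫⁻ u, ∫⁻ s, (∫⁻ t : ℝ, ENNReal.ofReal z * ENNReal.ofReal
            ((1 - Real.cos (s * g u / Real.sqrt z * t)) / t ^ 2)) ∂r ∂μ := by
          refine lintegral_congr fun u => ?_
          refine lintegral_lintegral_swap (Measurable.aemeasurable ?_)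
          simp only [Function.uncurry_def]
          fun_prop
      _ = ∫⁻ u, ∫⁻ s, (ENNReal.ofReal (Real.sqrt z) * ‖g u‖ₑ * absMomentConst) * ‖s‖ₑ ∂r ∂μ := by
          refine lintegral_congr fun u => lintegral_congr fun s => ?_
          rw [lintegral_const_mul' _ _ ENNReal.ofReal_ne_top, lintegral_one_sub_cos_mul]
          have : ENNReal.ofReal z * ‖s * g u / Real.sqrt z‖ₑ =
              ENNReal.ofReal (Real.sqrt z) * ‖g u‖ₑ * ‖s‖ₑ := by
            simp only [Real.enorm_eq_ofReal_abs]
            rw [← ENNReal.ofReal_mul hz.le, ← ENNReal.ofReal_mul hz'.le,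
              ← ENNReal.ofReal_mul (by positivity)]
            congr 1
            rw [abs_div, abs_mul, abs_of_pos hz']
            nth_rw 1 [← Real.mul_self_sqrt hz.le]
            field_simp
          rw [← mul_assoc, this]
          ring
      _ = _ := by
          have e : ∫⁻ s, ‖s‖ₑ ∂r = ENNReal.ofReal (∫ s, |s| ∂r) := by
            rw [ofReal_integral_eq_lintegral_ofReal hr (ae_of_all _ fun _ => abs_nonneg _)]
            simp_rw [Real.enorm_eq_ofReal_abs]
          have e2 (u : α) : ∫⁻ s, (ENNReal.ofReal (Real.sqrt z) * ‖g u‖ₑ * absMomentConst) * ‖s‖ₑ ∂r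
              = (absMomentConst * ENNReal.ofReal (Real.sqrt z * ∫ s, |s| ∂r)) * ‖g u‖ₑ := by
            rw [lintegral_const_mul _ measurable_enorm, e, ENNReal.ofReal_mul hz'.le]
            ring
          simp_rw [e2]
          rw [lintegral_const_mul _ hg.enorm, mul_assoc]
  rwa [ENNReal.mul_le_mul_iff_right absMomentConst_ne_zero absMomentConst_ne_top] at hcore

end

/-! ### Translations and the transposed convolution -/

noncomputable section

variable {d : ℕ}

/-- Translations are continuous in `L¹`. -/
theorem tendsto_lintegral_translate_sub {G : Space d → ℝ} (hG : MemLp G 1) :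
    Tendsto (fun a => ∫⁻ u, ‖G (a + u) - G u‖ₑ) (𝓝 0) (𝓝 0) := by
  have : Fact ((1 : ENNReal) ≠ ⊤) := ⟨ENNReal.one_ne_top⟩
  have h1 : Continuous fun a : Space d =>
      (DomAddAct.mk a +ᵥ hG.toLp G : Lp ℝ 1 (volume : Measure (Space d))) :=
    (DomAddAct.continuous_mk).vadd continuous_const
  have h2 := h1.tendsto 0
  rw [tendsto_iff_edist_tendsto_0] at h2
  refine h2.congr fun a => ?_
  rw [DomAddAct.mk_vadd_toLp, DomAddAct.mk_vadd_toLp, Lp.edist_toLp_toLp,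
    eLpNorm_one_eq_lintegral_enorm]
  simp

theorem enorm_translate_sub_le {G : Space d → ℝ} (hG : Measurable G) (a : Space d) :
    ∫⁻ u, ‖G (a + u) - G u‖ₑ ≤ 2 * ∫⁻ u, ‖G u‖ₑ := by
  calc ∫⁻ u, ‖G (a + u) - G u‖ₑ ≤ ∫⁻ u, (‖G (a + u)‖ₑ + ‖G u‖ₑ) :=
        lintegral_mono fun u => enorm_sub_le
    _ = _ := by
        rw [lintegral_add_left (by fun_prop), lintegral_add_left_eq_self (fun u => ‖G u‖ₑ) a,
          two_mul]

theorem lintegral_enorm_sub_left_eq {G : Space d → ℝ} (x y : Space d) :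
    ∫⁻ u, ‖G (y - u) - G (x - u)‖ₑ = ∫⁻ u, ‖G ((y - x) + u) - G u‖ₑ := by
  rw [← lintegral_sub_left_eq_self (fun u => ‖G ((y - x) + u) - G u‖ₑ) x]
  refine lintegral_congr fun u => ?_
  congr 3
  abel

theorem integrable_mul_translate {G f : Space d → ℝ} (hG : Integrable G) (hf : Continuous f)
    {C : ℝ} (hC : ∀ y, ‖f y‖ ≤ C) (u : Space d) : Integrable fun y => G (y - u) * f y :=
  (hG.comp_sub_right u).mul_bdd hf.aestronglyMeasurable (ae_of_all _ hC)

theorem measurable_adjConv {G f : Space d → ℝ} (hG : Measurable G) (hf : Measurable f) :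
    Measurable (adjConv G f) := by
  have h : Measurable fun p : Space d × Space d => G (p.2 - p.1) * f p.2 := by fun_prop
  exact (h.stronglyMeasurable.integral_prod_right' (ν := volume)).measurable

theorem adjConv_congr {G G' : Space d → ℝ} (h : G =ᵐ[volume] G') (f : Space d → ℝ) :
    adjConv G f = adjConv G' f := by
  funext u
  refine integral_congr_ae ?_
  have :=
    (measurePreserving_sub_right (volume : Measure (Space d)) u).quasiMeasurePreserving.ae_eq_comp h
  filter_upwards [this] with y hy
  simp only [Function.comp_apply] at hy
  rw [hy]

/-- Young's inequality in `L¹`. -/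
theorem lintegral_enorm_adjConv_le {G f : Space d → ℝ} (hG : Measurable G) (hf : Measurable f) :
    ∫⁻ u, ‖adjConv G f u‖ₑ ≤ (∫⁻ u, ‖G u‖ₑ) * ∫⁻ y, ‖f y‖ₑ := by
  calc ∫⁻ u, ‖adjConv G f u‖ₑ ≤ ∫⁻ u, ∫⁻ y, ‖G (y - u)‖ₑ * ‖f y‖ₑ :=
        lintegral_mono fun u => (enorm_integral_le_lintegral_enorm _).trans
          (by simp_rw [enorm_mul]; exact le_rfl)
    _ = ∫⁻ y, ∫⁻ u, ‖G (y - u)‖ₑ * ‖f y‖ₑ :=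
        lintegral_lintegral_swap (by fun_prop)
    _ = ∫⁻ y, (∫⁻ u, ‖G u‖ₑ) * ‖f y‖ₑ := by
        refine lintegral_congr fun y => ?_
        rw [lintegral_mul_const _ (by fun_prop),
          lintegral_sub_left_eq_self (fun u => ‖G u‖ₑ) y]
    _ = _ := lintegral_const_mul _ hf.enorm

theorem integrable_adjConv {G f : Space d → ℝ} (hG : Measurable G) (hGi : Integrable G)
    (hf : Measurable f) (hfi : Integrable f) : Integrable (adjConv G f) :=
  ⟨(measurable_adjConv hG hf).aestronglyMeasurable,
    (lintegral_enorm_adjConv_le hG hf).trans_lt (ENNReal.mul_lt_top hGi.2 hfi.2)⟩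

theorem norm_adjConv_le {G f : Space d → ℝ} (hGi : Integrable G) {C : ℝ} (hC : ∀ y, ‖f y‖ ≤ C)
    (u : Space d) : ‖adjConv G f u‖ ≤ C * ∫ x, ‖G x‖ := by
  calc ‖adjConv G f u‖ ≤ ∫ y, ‖G (y - u)‖ * C := by
        refine norm_integral_le_of_norm_le ((hGi.comp_sub_right u).norm.mul_const C)
          (ae_of_all _ fun y => ?_)
        rw [norm_mul]
        gcongr
        exact hC y
    _ = _ := by
        rw [integral_mul_const, integral_sub_right_eq_self (fun x => ‖G x‖) u, mul_comm]

theorem integrable_sq_adjConv {G : Space d → ℝ} (hG : Measurable G) (hGi : Integrable G)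
    (f : 𝓢(Space d, ℝ)) : Integrable fun u => adjConv G f u ^ 2 := by
  have h1 := integrable_adjConv hG hGi f.continuous.measurable f.integrable
  simp_rw [sq]
  exact h1.mul_bdd h1.1 (ae_of_all _ fun u =>
    norm_adjConv_le hGi (SchwartzMap.norm_le_seminorm ℝ f) u)

theorem adjConv_schwartz_smul {G : Space d → ℝ} (t : ℝ) (f : 𝓢(Space d, ℝ)) (u : Space d) :
    adjConv G (t • f : 𝓢(Space d, ℝ)) u = t * adjConv G f u := by
  rw [adjConv, adjConv, ← integral_const_mul]
  refine integral_congr_ae (ae_of_all _ fun y => ?_)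
  simp only [smul_apply, smul_eq_mul]
  ring

/-- The map `f ↦ (Ǧ * f)(u)` on Schwartz functions as a linear form. -/
def adjConvLin {G : Space d → ℝ} (hG : Integrable G) (u : Space d) : 𝓢(Space d, ℝ) →ₗ[ℝ] ℝ where
  toFun f := adjConv G f u
  map_add' f g := by
    rw [adjConv, adjConv, adjConv, ← integral_add
      (integrable_mul_translate hG f.continuous (SchwartzMap.norm_le_seminorm ℝ f) u)
      (integrable_mul_translate hG g.continuous (SchwartzMap.norm_le_seminorm ℝ g) u)]
    simp [mul_add]
  map_smul' t f := adjConv_schwartz_smul t f u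

/-- Averaging against a probability density `φ` close to `x`: the transposed convolution of `φ` is
close in `L¹` to `u ↦ G (x - u)`. -/
theorem lintegral_adjConv_sub_le {G φ : Space d → ℝ} (hG : Measurable G) (hGi : Integrable G)
    (hφ : Continuous φ) (hφ0 : ∀ y, 0 ≤ φ y) (hφ1 : ∫ y, φ y = 1) {C : ℝ} (hC : ∀ y, ‖φ y‖ ≤ C)
    (x : Space d) {ε : ENNReal} (hε : ∀ y, φ y ≠ 0 → ∫⁻ u, ‖G ((y - x) + u) - G u‖ₑ ≤ ε) :
    ∫⁻ u, ‖adjConv G φ u - G (x - u)‖ₑ ≤ ε := by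
  have hφi : Integrable φ := by
    by_contra h
    rw [integral_undef h] at hφ1
    exact zero_ne_one hφ1
  have h1 (u : Space d) : adjConv G φ u - G (x - u) = ∫ y, (G (y - u) - G (x - u)) * φ y := by
    have : ∫ y, G (x - u) * φ y = G (x - u) := by rw [integral_const_mul, hφ1, mul_one]
    simp_rw [sub_mul]
    rw [integral_sub (integrable_mul_translate hGi hφ hC u) (hφi.const_mul _), this, adjConv]
  have hφm : Measurable φ := hφ.measurable
  calc ∫⁻ u, ‖adjConv G φ u - G (x - u)‖ₑ
      ≤ ∫⁻ u, ∫⁻ y, ‖G (y - u) - G (x - u)‖ₑ * ‖φ y‖ₑ := by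
        refine lintegral_mono fun u => ?_
        rw [h1]
        refine (enorm_integral_le_lintegral_enorm _).trans ?_
        simp_rw [enorm_mul]
        exact le_rfl
    _ = ∫⁻ y, ∫⁻ u, ‖G (y - u) - G (x - u)‖ₑ * ‖φ y‖ₑ := lintegral_lintegral_swap (by fun_prop)
    _ = ∫⁻ y, (∫⁻ u, ‖G ((y - x) + u) - G u‖ₑ) * ‖φ y‖ₑ := by
        refine lintegral_congr fun y => ?_
        rw [lintegral_mul_const _ (by fun_prop), lintegral_enorm_sub_left_eq]
    _ ≤ ∫⁻ y, ε * ‖φ y‖ₑ := by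
        refine lintegral_mono fun y => ?_
        by_cases hy : φ y = 0
        · simp [hy]
        · exact mul_le_mul_left (hε y hy) _
    _ = ε := by
        rw [lintegral_const_mul _ hφm.enorm]
        have : ∫⁻ y, ‖φ y‖ₑ = 1 := by
          have h2 := ofReal_integral_eq_lintegral_ofReal hφi (ae_of_all _ hφ0)
          rw [hφ1, ENNReal.ofReal_one] at h2
          rw [h2]
          exact lintegral_congr fun y => Real.enorm_of_nonneg (hφ0 y)
        rw [this, mul_one]

/-! ### Approximate evaluation points -/

/-- A smooth probability density supported in the ball of radius `1 / (n + 1)`. -/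
def mollifierBump (d n : ℕ) : ContDiffBump (0 : Space d) :=
  ⟨1 / (n + 2), 1 / (n + 1), by positivity, by
    rw [one_div_lt_one_div (by positivity) (by positivity)]; linarith⟩

/-- The mollifier, as a Schwartz function. -/
def mollifier (d n : ℕ) : 𝓢(Space d, ℝ) :=
  ((mollifierBump d n).hasCompactSupport_normed (μ := volume)).toSchwartzMap
    ((mollifierBump d n).contDiff_normed)

theorem mollifier_apply (n : ℕ) (x : Space d) :
    mollifier d n x = (mollifierBump d n).normed volume x := rfl

/-- A test function which approximates the evaluation at `x` as `n → ∞`: a mollifier centred at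
the closest among `n` points of a dense sequence, so that only finitely many test functions are
used for a given `n`. -/
def approxDirac (d n : ℕ) : SimpleFunc (Space d) 𝓢(Space d, ℝ) :=
  (SimpleFunc.nearestPt (TopologicalSpace.denseSeq (Space d)) n).map
    fun b => SchwartzMap.compSubConstCLM ℝ b (mollifier d n)

theorem approxDirac_apply (n : ℕ) (x y : Space d) : approxDirac d n x y = mollifier d n
    (y - SimpleFunc.nearestPt (TopologicalSpace.denseSeq (Space d)) n x) := rfl

theorem approxDirac_nonneg (n : ℕ) (x y : Space d) : 0 ≤ approxDirac d n x y :=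
  ContDiffBump.nonneg_normed _ _

theorem integral_approxDirac (n : ℕ) (x : Space d) : ∫ y, approxDirac d n x y = 1 := by
  simp_rw [approxDirac_apply]
  rw [integral_sub_right_eq_self (fun y => mollifier d n y)]
  exact ContDiffBump.integral_normed _

/-- The `L¹`-distance of `Ǧ * δ` and `u ↦ G (x - u)`, for the approximate Dirac function `δ`
at `x`. -/
def approxError (G : Space d → ℝ) (n : ℕ) (x : Space d) : ENNReal :=
  ∫⁻ u, ‖adjConv G (approxDirac d n x) u - G (x - u)‖ₑ

theorem approxError_le {G : Space d → ℝ} (hG : Measurable G) (hGi : Integrable G) (n : ℕ)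
    (x : Space d) : approxError G n x ≤ 2 * ∫⁻ u, ‖G u‖ₑ :=
  lintegral_adjConv_sub_le hG hGi (approxDirac d n x).continuous (approxDirac_nonneg n x)
    (integral_approxDirac n x) (SchwartzMap.norm_le_seminorm ℝ _) x
    fun _ _ => enorm_translate_sub_le hG _

theorem tendsto_approxError {G : Space d → ℝ} (hG : Measurable G) (hGi : Integrable G)
    (x : Space d) : Tendsto (fun n => approxError G n x) atTop (𝓝 0) := by
  rw [ENNReal.tendsto_nhds_zero]
  intro ε hε
  have h1 := tendsto_lintegral_translate_sub (memLp_one_iff_integrable.2 hGi)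
  rw [ENNReal.tendsto_nhds_zero] at h1
  obtain ⟨δ, hδ, hball⟩ := Metric.eventually_nhds_iff.1 (h1 ε hε)
  have h2 : Tendsto (SimpleFunc.nearestPt (TopologicalSpace.denseSeq (Space d)) · x) atTop (𝓝 x) :=
    SimpleFunc.tendsto_nearestPt (TopologicalSpace.denseRange_denseSeq _ x)
  have h3 : Tendsto (fun n : ℕ => 1 / ((n : ℝ) + 1)) atTop (𝓝 0) :=
    tendsto_one_div_add_atTop_nhds_zero_nat
  filter_upwards [Metric.tendsto_nhds.1 h2 (δ / 2) (half_pos hδ),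
    h3.eventually (gt_mem_nhds (half_pos hδ))] with n hn1 hn2
  refine lintegral_adjConv_sub_le hG hGi (approxDirac d n x).continuous (approxDirac_nonneg n x)
    (integral_approxDirac n x) (SchwartzMap.norm_le_seminorm ℝ _) x fun y hy => hball ?_
  rw [approxDirac_apply, mollifier_apply] at hy
  have hy1 : y - SimpleFunc.nearestPt (TopologicalSpace.denseSeq (Space d)) n x ∈
      Function.support ((mollifierBump d n).normed volume) := hy
  rw [ContDiffBump.support_normed_eq, mem_ball_zero_iff] at hy1
  have hy2 : ‖y - SimpleFunc.nearestPt (TopologicalSpace.denseSeq (Space d)) n x‖ < δ / 2 :=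
    hy1.trans hn2
  rw [dist_zero_right]
  rw [dist_eq_norm] at hn1
  calc ‖y - x‖ ≤ ‖y - SimpleFunc.nearestPt (TopologicalSpace.denseSeq (Space d)) n x‖ +
        ‖SimpleFunc.nearestPt (TopologicalSpace.denseSeq (Space d)) n x - x‖ :=
        norm_sub_le_norm_sub_add_norm_sub _ _ _
    _ < δ := by linarith

theorem measurable_adjConv_approxDirac {G : Space d → ℝ} (hG : Measurable G) (n : ℕ) :
    Measurable fun p : Space d × Space d => adjConv G (approxDirac d n p.1) p.2 :=
  ((approxDirac d n).comp Prod.fst measurable_fst).measurable_bind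
    (fun (f : 𝓢(Space d, ℝ)) (p : Space d × Space d) => adjConv G f p.2)
    fun f => (measurable_adjConv hG f.continuous.measurable).comp measurable_snd

theorem measurable_approxError {G : Space d → ℝ} (hG : Measurable G) (n : ℕ) :
    Measurable (approxError G n) :=
  Measurable.lintegral_prod_right'
    (((measurable_adjConv_approxDirac hG n).sub (hG.comp (measurable_fst.sub measurable_snd))).enorm)

end

/-! ### The paths are functions -/

noncomputable section

variable {d : ℕ}

/-- The test function `∑ b, (∫ f 1_{s = b}) • b` for a simple function `s` with values in the
Schwartz functions, i.e. the integral of `f(x) s(x)`. -/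
def simpleAverage (s : SimpleFunc (Space d) 𝓢(Space d, ℝ)) (f : 𝓢(Space d, ℝ)) : 𝓢(Space d, ℝ) :=
  ∑ b ∈ s.range, (∫ x in s ⁻¹' {b}, f x) • b

theorem apply_simpleAverage (s : SimpleFunc (Space d) 𝓢(Space d, ℝ)) (f : 𝓢(Space d, ℝ))
    (L : 𝓢(Space d, ℝ) →ₗ[ℝ] ℝ) : L (simpleAverage s f) = ∫ x, L (s x) * f x := by
  classical
  have h1 (x : Space d) : L (s x) * f x =
      ∑ b ∈ s.range, (s ⁻¹' {b}).indicator (fun x => L b * f x) x := by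
    rw [Finset.sum_eq_single_of_mem (s x) (s.mem_range_self x)]
    · rw [Set.indicator_of_mem (by simp)]
    · intro b _ hb
      rw [Set.indicator_of_notMem (by simpa using hb.symm)]
  simp_rw [h1]
  rw [integral_finsetSum _ fun b _ =>
    (f.integrable.const_mul _).indicator (s.measurableSet_preimage _), simpleAverage, map_sum]
  refine Finset.sum_congr rfl fun b _ => ?_
  rw [integral_indicator (s.measurableSet_preimage _), integral_const_mul, map_smul, smul_eq_mul,
    mul_comm]

/-- The `L¹`-distance of `Ǧ * f` and of `Ǧ` convolved with the discretization of `f`. -/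
theorem lintegral_adjConv_sub_simpleAverage_le {G : Space d → ℝ} (hG : Measurable G)
    (hGi : Integrable G) (f : 𝓢(Space d, ℝ)) (n : ℕ) :
    ∫⁻ u, ‖adjConv G (f - simpleAverage (approxDirac d n) f : 𝓢(Space d, ℝ)) u‖ₑ ≤
      ∫⁻ x, approxError G n x * ‖f x‖ₑ := by
  have hm := measurable_adjConv_approxDirac hG n
  have hm' : Measurable fun p : Space d × Space d =>
      ‖adjConv G (approxDirac d n p.1) p.2 - G (p.1 - p.2)‖ₑ * ‖f p.1‖ₑ :=
    ((hm.sub (by fun_prop)).enorm).mul ((f.continuous.measurable.comp measurable_fst).enorm)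
  have h1 (u : Space d) :
      ‖adjConv G (f - simpleAverage (approxDirac d n) f : 𝓢(Space d, ℝ)) u‖ₑ ≤
        ∫⁻ x, ‖adjConv G (approxDirac d n x) u - G (x - u)‖ₑ * ‖f x‖ₑ := by
    have h2 : adjConv G (f - simpleAverage (approxDirac d n) f : 𝓢(Space d, ℝ)) u =
        (∫ x, G (x - u) * f x) - ∫ x, adjConv G (approxDirac d n x) u * f x := by
      have := (adjConvLin hGi u).map_sub f (simpleAverage (approxDirac d n) f)
      rw [apply_simpleAverage] at this
      exact this
    have h3 : Integrable fun x => adjConv G (approxDirac d n x) u * f x := by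
      have hmu : Measurable fun x => adjConv G (approxDirac d n x) u :=
        hm.comp (measurable_id.prodMk measurable_const)
      obtain ⟨C, hC⟩ : ∃ C, ∀ x, ‖adjConv G (approxDirac d n x) u‖ ≤ C := by
        refine ⟨∑ b ∈ (approxDirac d n).range, ‖adjConv G b u‖, fun x => ?_⟩
        exact Finset.single_le_sum (f := fun b : 𝓢(Space d, ℝ) => ‖adjConv G b u‖)
          (fun _ _ => norm_nonneg _) ((approxDirac d n).mem_range_self x)
      exact f.integrable.bdd_mul hmu.aestronglyMeasurable (ae_of_all _ hC)
    rw [h2, ← integral_sub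
      (integrable_mul_translate hGi f.continuous (SchwartzMap.norm_le_seminorm ℝ f) u) h3]
    refine (enorm_integral_le_lintegral_enorm _).trans (lintegral_mono fun x => ?_)
    rw [← sub_mul, enorm_mul, enorm_sub_rev]
  refine (lintegral_mono h1).trans ?_
  rw [lintegral_lintegral_swap (f := fun u x => ‖adjConv G (approxDirac d n x) u - G (x - u)‖ₑ *
    ‖f x‖ₑ) (hm'.comp measurable_swap).aemeasurable]
  refine lintegral_mono fun x => le_of_eq ?_
  rw [lintegral_mul_const' _ _ enorm_ne_top, approxError]

/-- The approximation errors are bounded by `2 ‖G‖₁`, so they vanish when integrated against an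
integrable weight. -/
theorem tendsto_lintegral_approxError_mul {G : Space d → ℝ} (hG : Measurable G)
    (hGi : Integrable G) {μ : Measure (Space d)} {w : Space d → ENNReal} (hw : Measurable w)
    (hwi : ∫⁻ x, w x ∂μ ≠ ⊤) (hwt : ∀ x, w x ≠ ⊤) :
    Tendsto (fun n => ∫⁻ x, approxError G n x * w x ∂μ) atTop (𝓝 0) := by
  have h := tendsto_lintegral_of_dominated_convergence (μ := μ)
    (F := fun n x => approxError G n x * w x) (f := fun _ => 0)
    (fun x => (2 * ∫⁻ u, ‖G u‖ₑ) * w x) (fun n => (measurable_approxError hG n).mul hw)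
    (fun n => ae_of_all _ fun x => mul_le_mul_left (approxError_le hG hGi n x) _)
    (by
      rw [lintegral_const_mul _ hw]
      exact ENNReal.mul_ne_top (ENNReal.mul_ne_top (by simp) hGi.2.ne) hwi)
    (ae_of_all _ fun x => by
      simpa using ENNReal.Tendsto.mul_const (tendsto_approxError hG hGi x) (Or.inr (hwt x)))
  simpa using h

/-- The `n`-th approximation of the path `ω` at the point `x`: the value of `ω` on the approximate
Dirac function. It is a step function of `x`, hence jointly measurable in `x` and `ω`. -/
def approxPath (d n : ℕ) (p : Space d × TempDist d) : ℝ := p.2 (approxDirac d n p.1)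

theorem measurable_approxPath (n : ℕ) : Measurable (approxPath d n) :=
  ((approxDirac d n).comp Prod.fst measurable_fst).measurable_bind
    (fun (f : 𝓢(Space d, ℝ)) (p : Space d × TempDist d) => p.2 f)
    fun f => (measurable_eval f).comp measurable_snd

section

variable {P : Measure (TempDist d)} {G : Space d → ℝ} {K : ENNReal}

theorem lintegral_approxPath_le (hG : Measurable G) (hGi : Integrable G)
    (hP : ∀ f : 𝓢(Space d, ℝ), ∫⁻ ω, ‖ω f‖ₑ ∂P ≤ K * ∫⁻ u, ‖adjConv G f u‖ₑ) (n : ℕ)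
    (x : Space d) : ∫⁻ ω, ‖approxPath d n (x, ω)‖ₑ ∂P ≤ K * (3 * ∫⁻ u, ‖G u‖ₑ) := by
  refine (hP (approxDirac d n x)).trans (mul_le_mul_right ?_ _)
  calc ∫⁻ u, ‖adjConv G (approxDirac d n x) u‖ₑ
      ≤ ∫⁻ u, (‖adjConv G (approxDirac d n x) u - G (x - u)‖ₑ + ‖G (x - u)‖ₑ) := by
        refine lintegral_mono fun u => ?_
        nth_rw 1 [← sub_add_cancel (adjConv G (approxDirac d n x) u) (G (x - u))]
        exact enorm_add_le _ _
    _ = approxError G n x + ∫⁻ u, ‖G u‖ₑ := by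
        rw [lintegral_add_right _ (by fun_prop), lintegral_sub_left_eq_self (fun u => ‖G u‖ₑ) x,
          approxError]
    _ ≤ 2 * (∫⁻ u, ‖G u‖ₑ) + ∫⁻ u, ‖G u‖ₑ := add_le_add_left (approxError_le hG hGi n x) _
    _ = 3 * ∫⁻ u, ‖G u‖ₑ := by ring

theorem lintegral_adjConv_approxDirac_sub_le (hG : Measurable G) (n k : ℕ) (x : Space d)
    (hGi : Integrable G) :
    ∫⁻ u, ‖adjConv G (approxDirac d n x - approxDirac d k x : 𝓢(Space d, ℝ)) u‖ₑ ≤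
      approxError G n x + approxError G k x := by
  have hm (n : ℕ) : Measurable fun u => ‖adjConv G (approxDirac d n x) u - G (x - u)‖ₑ :=
    ((measurable_adjConv hG (approxDirac d n x).continuous.measurable).sub (by fun_prop)).enorm
  rw [approxError, approxError, ← lintegral_add_left (hm n)]
  refine lintegral_mono fun u => ?_
  have := (adjConvLin hGi u).map_sub (approxDirac d n x) (approxDirac d k x)
  have e : adjConv G (approxDirac d n x - approxDirac d k x : 𝓢(Space d, ℝ)) u =
      (adjConv G (approxDirac d n x) u - G (x - u)) -
        (adjConv G (approxDirac d k x) u - G (x - u)) := by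
    rw [sub_sub_sub_cancel_right]
    exact this
  rw [e]
  exact enorm_sub_le

variable [IsProbabilityMeasure P]

/-- If `E|X(f)|` is controlled by the `L¹`-norm of `Ǧ * f`, the approximations of the paths
converge in `L¹`. -/
theorem exists_tendsto_approxPath (hG : Measurable G) (hGi : Integrable G) (hK : K ≠ ⊤)
    (hP : ∀ f : 𝓢(Space d, ℝ), ∫⁻ ω, ‖ω f‖ₑ ∂P ≤ K * ∫⁻ u, ‖adjConv G f u‖ₑ) :
    (∀ n, MemLp (approxPath d n) 1 ((weightMeasure d).prod P)) ∧
    ∃ h : Space d × TempDist d → ℝ, Measurable h ∧ Integrable h ((weightMeasure d).prod P) ∧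
      Tendsto (fun n => eLpNorm (approxPath d n - h) 1 ((weightMeasure d).prod P)) atTop (𝓝 0) := by
  have hmem (n : ℕ) : MemLp (approxPath d n) 1 ((weightMeasure d).prod P) := by
    refine ⟨(measurable_approxPath n).aestronglyMeasurable, ?_⟩
    rw [eLpNorm_one_eq_lintegral_enorm,
      lintegral_prod _ (measurable_approxPath n).enorm.aemeasurable]
    refine (lintegral_mono fun x => lintegral_approxPath_le hG hGi hP n x).trans_lt ?_
    rw [lintegral_const]
    exact ENNReal.mul_lt_top (ENNReal.mul_lt_top hK.lt_top
      (ENNReal.mul_lt_top (by simp) hGi.2)) (measure_lt_top _ _)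
  refine ⟨hmem, ?_⟩
  let e (n : ℕ) : ENNReal := K * ∫⁻ x, approxError G n x ∂(weightMeasure d)
  have he : Tendsto e atTop (𝓝 0) := by
    have h1 := tendsto_lintegral_approxError_mul hG hGi (μ := weightMeasure d) (w := fun _ => 1)
      measurable_const (by simp) (by simp)
    simp only [mul_one] at h1
    simpa using ENNReal.Tendsto.const_mul h1 (Or.inr hK)
  have hd (n k : ℕ) : eLpNorm (approxPath d n - approxPath d k) 1 ((weightMeasure d).prod P) ≤
      e n + e k := by
    rw [eLpNorm_one_eq_lintegral_enorm, lintegral_prod _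
      ((measurable_approxPath n).sub (measurable_approxPath k)).enorm.aemeasurable]
    calc _ ≤ ∫⁻ x, K * (approxError G n x + approxError G k x) ∂(weightMeasure d) := by
          refine lintegral_mono fun x => ?_
          refine le_trans (le_of_eq ?_) ((hP (approxDirac d n x - approxDirac d k x)).trans
            (mul_le_mul_right (lintegral_adjConv_approxDirac_sub_le hG n k x hGi) _))
          refine lintegral_congr fun ω => ?_
          rw [map_sub]
          rfl
      _ = e n + e k := by
          rw [lintegral_const_mul' _ _ hK, lintegral_add_left (measurable_approxError hG n), mul_add]
  let u (n : ℕ) := (hmem n).toLp (approxPath d n)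
  have hu : CauchySeq u := by
    rw [EMetric.cauchySeq_iff]
    intro ε hε
    obtain ⟨N, hN⟩ := eventually_atTop.1 (he.eventually (gt_mem_nhds (ENNReal.half_pos hε.ne')))
    refine ⟨N, fun n hn k hk => ?_⟩
    rw [Lp.edist_toLp_toLp]
    refine (hd n k).trans_lt ?_
    rw [← ENNReal.add_halves ε]
    exact ENNReal.add_lt_add (hN n hn) (hN k hk)
  obtain ⟨h, hh⟩ := cauchySeq_tendsto_of_complete hu
  refine ⟨h, (Lp.stronglyMeasurable h).measurable, memLp_one_iff_integrable.1 (Lp.memLp h), ?_⟩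
  rw [tendsto_iff_edist_tendsto_0] at hh
  refine hh.congr fun n => ?_
  rw [Lp.edist_def]
  refine eLpNorm_congr_ae ?_
  filter_upwards [(hmem n).coeFn_toLp] with p hp
  simp only [Pi.sub_apply]
  rw [hp]

/-- The limit of the step function approximations represents the path. For a fixed test function
this is an estimate in `L¹(P)`; a countable dense set of test functions suffices. -/
theorem ae_isGivenBy (hG : Measurable G) (hGi : Integrable G) (hK : K ≠ ⊤)
    (hP : ∀ f : 𝓢(Space d, ℝ), ∫⁻ ω, ‖ω f‖ₑ ∂P ≤ K * ∫⁻ u, ‖adjConv G f u‖ₑ)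
    (hmem : ∀ n, MemLp (approxPath d n) 1 ((weightMeasure d).prod P))
    {h : Space d × TempDist d → ℝ} (hm : Measurable h)
    (hi : Integrable h ((weightMeasure d).prod P))
    (hlim : Tendsto (fun n => eLpNorm (approxPath d n - h) 1 ((weightMeasure d).prod P)) atTop
      (𝓝 0)) : ∀ᵐ ω ∂P, IsGivenBy ω fun x => h (x, ω) := by
  obtain ⟨D, hDc, hD⟩ := SchwartzMap.exists_countable_dense (E := Space d)
  have h1 : ∀ f ∈ D, ∀ᵐ ω ∂P, ω f = ∫ x, h (x, ω) * f x := by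
    intro f _
    have hmf : Measurable fun ω : TempDist d => ∫ x, h (x, ω) * f x := by
      have : Measurable fun p : TempDist d × Space d => h (p.2, p.1) * f p.2 :=
        (hm.comp measurable_swap).mul (f.continuous.measurable.comp measurable_snd)
      exact (this.stronglyMeasurable.integral_prod_right' (ν := volume)).measurable
    let B : ENNReal := ENNReal.ofReal (2 ^ (d + 1) * weightSeminorm d f)
    -- the error of the discretization of `f`, and the error of the approximation of the path
    have hbound (n : ℕ) : ∫⁻ ω, ‖ω f - ∫ x, h (x, ω) * f x‖ₑ ∂P ≤
        K * (∫⁻ x, approxError G n x * ‖f x‖ₑ) +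
          B * eLpNorm (approxPath d n - h) 1 ((weightMeasure d).prod P) := by
      have hdm : Measurable (approxPath d n - h) := (measurable_approxPath n).sub hm
      have ha : ∫⁻ ω, ‖ω (f - simpleAverage (approxDirac d n) f)‖ₑ ∂P ≤
          K * ∫⁻ x, approxError G n x * ‖f x‖ₑ :=
        (hP _).trans (mul_le_mul_right (lintegral_adjConv_sub_simpleAverage_le hG hGi f n) _)
      have hb : ∫⁻ ω, B * ∫⁻ x, ‖(approxPath d n - h) (x, ω)‖ₑ ∂(weightMeasure d) ∂P =
          B * eLpNorm (approxPath d n - h) 1 ((weightMeasure d).prod P) := by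
        rw [lintegral_const_mul' _ _ ENNReal.ofReal_ne_top, eLpNorm_one_eq_lintegral_enorm,
          lintegral_prod_symm _ hdm.enorm.aemeasurable]
      refine le_trans ?_ (add_le_add ha hb.le)
      rw [← lintegral_add_left (measurable_eval _).enorm]
      refine lintegral_mono_ae ?_
      filter_upwards [hi.prod_left_ae, (memLp_one_iff_integrable.1 (hmem n)).prod_left_ae]
        with ω hω1 hω2
      have e1 : ω (simpleAverage (approxDirac d n) f) = ∫ x, approxPath d n (x, ω) * f x :=
        apply_simpleAverage (approxDirac d n) f (ω : 𝓢(Space d, ℝ) →ₗ[ℝ] ℝ)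
      have e2 : ω f - ∫ x, h (x, ω) * f x = ω (f - simpleAverage (approxDirac d n) f) +
          ∫ x, (approxPath d n - h) (x, ω) * f x := by
        have : ∫ x, (approxPath d n - h) (x, ω) * f x =
            (∫ x, approxPath d n (x, ω) * f x) - ∫ x, h (x, ω) * f x := by
          rw [← integral_sub (integrable_mul_schwartz hω2 f) (integrable_mul_schwartz hω1 f)]
          simp [sub_mul]
        rw [this, map_sub, e1]
        ring
      rw [e2]
      refine (enorm_add_le _ _).trans (add_le_add_right ?_ _)
      refine (enorm_integral_le_lintegral_enorm _).trans ?_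
      simp_rw [enorm_mul]
      exact lintegral_mul_schwartz_le f (by fun_prop)
    have hzero : ∫⁻ ω, ‖ω f - ∫ x, h (x, ω) * f x‖ₑ ∂P = 0 := by
      have t1 := tendsto_lintegral_approxError_mul hG hGi (μ := volume) (w := fun x => ‖f x‖ₑ)
        f.continuous.measurable.enorm f.integrable.2.ne (fun _ => enorm_ne_top)
      have t2 := (ENNReal.Tendsto.const_mul t1 (Or.inr hK)).add
        (ENNReal.Tendsto.const_mul hlim (Or.inr (ENNReal.ofReal_ne_top (r := 2 ^ (d + 1) *
          weightSeminorm d f))))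
      rw [mul_zero, mul_zero, add_zero] at t2
      exact le_antisymm (ge_of_tendsto' t2 hbound) (by simp)
    have hmd : Measurable fun ω : TempDist d => ‖ω f - ∫ x, h (x, ω) * f x‖ₑ :=
      ((measurable_eval f).sub hmf).enorm
    rw [lintegral_eq_zero_iff hmd] at hzero
    filter_upwards [hzero] with ω hω
    simpa [sub_eq_zero] using hω
  filter_upwards [(ae_ball_iff hDc).2 h1, hi.prod_left_ae] with ω hω1 hω2
  exact isGivenBy_of_dense hD hω2 hω1

end

end

/-! ### Differences of translates which are not square integrable -/

noncomputable section

variable {d : ℕ}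

/-- The Cauchy-Schwarz inequality against the constant function `1`. -/
theorem sq_lintegral_le {α : Type*} [MeasurableSpace α] (μ : Measure α) {f : α → ENNReal}
    (hf : AEMeasurable f μ) : (∫⁻ x, f x ∂μ) ^ 2 ≤ μ Set.univ * ∫⁻ x, f x ^ 2 ∂μ := by
  have h := ENNReal.lintegral_mul_le_Lp_mul_Lq μ Real.HolderConjugate.two_two hf
    (aemeasurable_const (b := (1 : ENNReal)))
  simp only [Pi.mul_apply, mul_one, ENNReal.rpow_ofNat, one_pow, lintegral_one] at h
  calc (∫⁻ x, f x ∂μ) ^ 2 ≤ ((∫⁻ x, f x ^ 2 ∂μ) ^ (1 / 2 : ℝ) * μ Set.univ ^ (1 / 2 : ℝ)) ^ 2 := by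
        gcongr
    _ = _ := by
        rw [mul_pow, ← ENNReal.rpow_natCast, ← ENNReal.rpow_mul, ← ENNReal.rpow_natCast,
          ← ENNReal.rpow_mul]
        norm_num
        rw [mul_comm]

/-- If `G` is integrable and the `L²`-norms of `G (a + ·) - G` are bounded for `a` in a set of
positive measure, then `G` is square integrable: the average of `G (a + ·)` over such `a` is bounded
and integrable. -/
theorem memLp_two_of_translate_sub {G : Space d → ℝ} (hG : Measurable G) (hGi : Integrable G)
    {A : Set (Space d)} (hA : MeasurableSet A) (hA0 : volume A ≠ 0) (hA1 : volume A ≠ ⊤)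
    {M : ENNReal} (hM : M ≠ ⊤) (h : ∀ a ∈ A, ∫⁻ u, ‖G (a + u) - G u‖ₑ ^ 2 ≤ M) : MemLp G 2 := by
  have hfm : Measurable (A.indicator (fun _ => (1 : ℝ))) := measurable_const.indicator hA
  have hfi : Integrable (A.indicator (fun _ => (1 : ℝ))) :=
    (integrable_indicator_iff hA).2 (integrableOn_const hA1)
  have hfb (y : Space d) : ‖A.indicator (fun _ => (1 : ℝ)) y‖ ≤ 1 := by
    by_cases hy : y ∈ A <;> simp [hy]
  -- `H₂ u` is the integral of `G (a + u)` over `a ∈ A`, and `volume A * G = H₂ - H₁`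
  let H₂ : Space d → ℝ := fun u => adjConv G (A.indicator fun _ => 1) (-u)
  let H₁ : Space d → ℝ := fun u => ∫ a in A, (G (a + u) - G u)
  have e₂ (u : Space d) : H₂ u = ∫ a in A, G (a + u) := by
    simp only [H₂, adjConv, sub_neg_eq_add]
    rw [← integral_indicator hA]
    congr with y
    by_cases hy : y ∈ A <;> simp [hy]
  have e₁ (u : Space d) : H₁ u = H₂ u - volume.real A * G u := by
    rw [e₂]
    simp only [H₁]
    rw [integral_sub (hGi.comp_add_right u).integrableOn (integrableOn_const hA1), setIntegral_const,
      smul_eq_mul]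
  have hH₂i : Integrable H₂ := (integrable_adjConv hG hGi hfm hfi).comp_neg
  have hH₂ : MemLp H₂ 2 := by
    rw [memLp_two_iff_integrable_sq hH₂i.1]
    simp_rw [sq]
    exact hH₂i.mul_bdd hH₂i.1 (ae_of_all _ fun u => norm_adjConv_le hGi hfb (-u))
  have hmm : Measurable fun p : Space d × Space d => G (p.2 + p.1) - G p.1 := by fun_prop
  have hH₁ : MemLp H₁ 2 := by
    have hm : Measurable H₁ :=
      (hmm.stronglyMeasurable.integral_prod_right' (ν := volume.restrict A)).measurable
    refine ⟨hm.aestronglyMeasurable, ?_⟩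
    rw [eLpNorm_lt_top_iff_lintegral_rpow_enorm_lt_top two_ne_zero ENNReal.ofNat_ne_top]
    simp only [ENNReal.toReal_ofNat, ENNReal.rpow_ofNat]
    calc ∫⁻ u, ‖H₁ u‖ₑ ^ 2 ≤ ∫⁻ u, volume A * ∫⁻ a in A, ‖G (a + u) - G u‖ₑ ^ 2 := by
          refine lintegral_mono fun u => ?_
          have hs := sq_lintegral_le (volume.restrict A) (f := fun a => ‖G (a + u) - G u‖ₑ)
            (by fun_prop)
          rw [Measure.restrict_apply_univ] at hs
          refine le_trans ?_ hs
          gcongr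
          exact enorm_integral_le_lintegral_enorm _
      _ = volume A * ∫⁻ a in A, ∫⁻ u, ‖G (a + u) - G u‖ₑ ^ 2 := by
          rw [lintegral_const_mul' _ _ hA1, lintegral_lintegral_swap (by fun_prop)]
      _ ≤ volume A * ∫⁻ _ in A, M := by
          gcongr 1
          exact setLIntegral_mono measurable_const h
      _ < ⊤ := by
          rw [setLIntegral_const]
          exact ENNReal.mul_lt_top hA1.lt_top (ENNReal.mul_lt_top hM.lt_top hA1.lt_top)
  have hr : volume.real A ≠ 0 := (ENNReal.toReal_pos hA0 hA1).ne'
  have := (hH₂.sub hH₁).const_mul (volume.real A)⁻¹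
  convert this using 1
  funext u
  simp only [Pi.sub_apply, e₁]
  field_simp
  ring

theorem ae_lintegral_translate_sub_sq_eq_top {G : Space d → ℝ} (hG : Measurable G)
    (hGi : Integrable G) (hG2 : ¬ MemLp G 2) :
    ∀ᵐ a : Space d, ∫⁻ u, ‖G (a + u) - G u‖ₑ ^ 2 = ⊤ := by
  have hLm : Measurable fun a : Space d => ∫⁻ u, ‖G (a + u) - G u‖ₑ ^ 2 := by
    refine Measurable.lintegral_prod_right'
      (f := fun p : Space d × Space d => ‖G (p.1 + p.2) - G p.2‖ₑ ^ 2) ?_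
    fun_prop
  -- otherwise one of these countably many sets of finite measure would have positive measure
  let A (M : ℕ) : Set (Space d) :=
    {a | ∫⁻ u, ‖G (a + u) - G u‖ₑ ^ 2 ≤ M} ∩ Metric.ball 0 M
  have hA (M : ℕ) : volume (A M) = 0 := by
    by_contra h0
    refine hG2 (memLp_two_of_translate_sub hG hGi (A := A M)
      ((measurableSet_le hLm measurable_const).inter measurableSet_ball) h0 ?_
      (ENNReal.natCast_ne_top M) fun a ha => ha.1)
    exact ((measure_mono Set.inter_subset_right).trans_lt measure_ball_lt_top).ne
  refine measure_mono_null (fun a ha => ?_) (measure_iUnion_null hA)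
  simp only [Set.mem_compl_iff, Set.mem_ofPred_eq] at ha
  obtain ⟨n, hn⟩ := ENNReal.exists_nat_gt ha
  obtain ⟨k, hk⟩ := exists_nat_gt ‖a‖
  refine Set.mem_iUnion.2 ⟨max n k, ?_, ?_⟩
  · refine hn.le.trans ?_
    exact_mod_cast le_max_left n k
  · rw [mem_ball_zero_iff]
    refine hk.trans_le ?_
    exact_mod_cast le_max_right n k

/-- For almost all `x` and `y`, the difference of the translates of an integrable function
which is not square integrable is not square integrable. -/
theorem ae_lintegral_sub_sq_eq_top {G : Space d → ℝ} (hG : Measurable G)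
    (hGi : Integrable G) (hG2 : ¬ MemLp G 2) :
    ∀ᵐ p : Space d × Space d, ∫⁻ u, ‖G (p.1 - u) - G (p.2 - u)‖ₑ ^ 2 = ⊤ := by
  have hq : Measure.QuasiMeasurePreserving (fun p : Space d × Space d => p.1 - p.2) :=
    Measure.quasiMeasurePreserving_fst.comp
      (measurePreserving_sub_prod volume volume).quasiMeasurePreserving
  filter_upwards [hq.ae (ae_lintegral_translate_sub_sq_eq_top hG hGi hG2)] with p hp
  rw [← hp, ← lintegral_sub_left_eq_self (fun u => ‖G ((p.1 - p.2) + u) - G u‖ₑ ^ 2) p.2]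
  refine lintegral_congr fun u => ?_
  congr 4
  abel

/-! ### The two-point exponent -/

/-- The exponent `∫ ψ_z (α (G (x - u) - G (y - u))) du`, so that `exp` of its negative is the
expectation of `cos (α (X(x) - X(y)))`. -/
def pairExponent (r : Measure ℝ) (G : Space d → ℝ) (z α : ℝ) (p : Space d × Space d) : ℝ :=
  ∫ u, poissonExponent r z (α * (G (p.1 - u) - G (p.2 - u)))

section

variable {r : Measure ℝ} {G : Space d → ℝ}

theorem measurable_pairExponent [SFinite r] (hG : Measurable G) (z : ℝ) :
    Measurable fun q : ℝ × Space d × Space d => pairExponent r G z q.1 q.2 := by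
  have h : Measurable fun q : (ℝ × Space d × Space d) × Space d =>
      poissonExponent r z (q.1.1 * (G (q.1.2.1 - q.2) - G (q.1.2.2 - q.2))) :=
    (measurable_poissonExponent z).comp (by fun_prop)
  exact (h.stronglyMeasurable.integral_prod_right' (ν := volume)).measurable

theorem pairExponent_nonneg {z : ℝ} (hz : 0 ≤ z) (α : ℝ) (p : Space d × Space d) :
    0 ≤ pairExponent r G z α p :=
  integral_nonneg fun _ => poissonExponent_nonneg hz _

theorem integrable_poissonExponent_comp [IsFiniteMeasure r] (hr : Integrable (fun s => |s|) r)
    {z : ℝ} (hz : 0 < z) {g : Space d → ℝ} (hgi : Integrable g) :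
    Integrable fun u => poissonExponent r z (g u) := by
  refine Integrable.mono' (hgi.norm.const_mul (Real.sqrt z * ∫ s, |s| ∂r))
    ((measurable_poissonExponent z).comp_aemeasurable hgi.1.aemeasurable).aestronglyMeasurable
    (ae_of_all _ fun u => ?_)
  rw [Real.norm_of_nonneg (poissonExponent_nonneg hz.le _)]
  exact poissonExponent_le_abs hr hz _

theorem integrable_pairExponent [IsFiniteMeasure r] (hr : Integrable (fun s => |s|) r)
    {z : ℝ} (hz : 0 < z) (hGi : Integrable G) (α : ℝ) (p : Space d × Space d) :
    Integrable fun u => poissonExponent r z (α * (G (p.1 - u) - G (p.2 - u))) :=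
  integrable_poissonExponent_comp hr hz
    (((hGi.comp_sub_left p.1).sub (hGi.comp_sub_left p.2)).const_mul α)

/-- Fatou's lemma: the exponent diverges as `z → ∞` if the Gaussian one is infinite. -/
theorem tendsto_pairExponent [IsFiniteMeasure r] (hr : Integrable (fun s => |s|) r)
    (hr2 : Integrable (fun s => s ^ 2) r) (hσ : 0 < ∫ s, s ^ 2 ∂r) (hG : Measurable G)
    (hGi : Integrable G) {α : ℝ} (hα : α ≠ 0) {p : Space d × Space d}
    (hp : ∫⁻ u, ‖G (p.1 - u) - G (p.2 - u)‖ₑ ^ 2 = ⊤) :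
    Tendsto (fun z => pairExponent r G z α p) atTop atTop := by
  have h1 : ∫⁻ u, liminf (fun z => ENNReal.ofReal (poissonExponent r z
      (α * (G (p.1 - u) - G (p.2 - u))))) atTop = ⊤ := by
    have h2 (u : Space d) : liminf (fun z => ENNReal.ofReal (poissonExponent r z
        (α * (G (p.1 - u) - G (p.2 - u))))) atTop =
        ENNReal.ofReal ((∫ s, s ^ 2 ∂r) / 2 * α ^ 2) * ‖G (p.1 - u) - G (p.2 - u)‖ₑ ^ 2 := by
      rw [(ENNReal.tendsto_ofReal (tendsto_poissonExponent hr2 _)).liminf_eq, mul_pow, ← mul_assoc,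
        ENNReal.ofReal_mul (by positivity), Real.enorm_eq_ofReal_abs,
        ← ENNReal.ofReal_pow (abs_nonneg _), sq_abs]
    simp_rw [h2]
    rw [lintegral_const_mul _ (by fun_prop), hp, ENNReal.mul_top]
    have : 0 < (∫ s, s ^ 2 ∂r) / 2 * α ^ 2 := by positivity
    simpa using this
  have h3 := lintegral_liminf_le (μ := (volume : Measure (Space d))) (u := (atTop : Filter ℝ))
    (f := fun z u => ENNReal.ofReal (poissonExponent r z (α * (G (p.1 - u) - G (p.2 - u)))))
    (fun z => ((measurable_poissonExponent z).comp (by fun_prop)).ennreal_ofReal)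
  rw [h1, top_le_iff] at h3
  have h4 : Tendsto (fun z => ENNReal.ofReal (pairExponent r G z α p)) atTop (𝓝 ⊤) := by
    refine tendsto_of_le_liminf_of_limsup_le ?_ le_top
    rw [← h3]
    refine le_of_eq (liminf_congr ?_)
    filter_upwards [eventually_gt_atTop 0] with z hz
    rw [pairExponent, ofReal_integral_eq_lintegral_ofReal (integrable_pairExponent hr hz hGi α p)
      (ae_of_all _ fun u => poissonExponent_nonneg hz.le _)]
  exact ENNReal.tendsto_ofReal_nhds_top.1 h4

/-- The integral over `Λ × Λ` of the expectation of `cos (α (X(x) - X(y)))`. -/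
def pairAverage (r : Measure ℝ) (G : Space d → ℝ) (Λ : Set (Space d)) (z α : ℝ) : ℝ :=
  ∫ p in Λ ×ˢ Λ, Real.exp (-pairExponent r G z α p)

theorem measurable_pairAverage [SFinite r] (hG : Measurable G) (Λ : Set (Space d)) (z : ℝ) :
    Measurable (pairAverage r G Λ z) := by
  have h : Measurable fun q : ℝ × Space d × Space d => Real.exp (-pairExponent r G z q.1 q.2) :=
    (measurable_pairExponent hG z).neg.exp
  exact (h.stronglyMeasurable.integral_prod_right'
    (ν := (volume : Measure (Space d × Space d)).restrict (Λ ×ˢ Λ))).measurable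

theorem pairAverage_nonneg (Λ : Set (Space d)) (z α : ℝ) : 0 ≤ pairAverage r G Λ z α :=
  integral_nonneg fun _ => (Real.exp_pos _).le

theorem volume_prod_self_ne_top {Λ : Set (Space d)} (hΛ : IsCompact Λ) :
    (volume : Measure (Space d × Space d)) (Λ ×ˢ Λ) ≠ ⊤ :=
  (hΛ.prod hΛ).measure_lt_top.ne

theorem exp_neg_pairExponent_le_one {z : ℝ} (hz : 0 ≤ z) (α : ℝ) (p : Space d × Space d) :
    ‖Real.exp (-pairExponent r G z α p)‖ ≤ 1 := by
  rw [Real.norm_of_nonneg (Real.exp_pos _).le, Real.exp_le_one_iff]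
  linarith [pairExponent_nonneg (r := r) (G := G) hz α p]

theorem pairAverage_le {Λ : Set (Space d)} (hΛ : IsCompact Λ) {z : ℝ} (hz : 0 ≤ z) (α : ℝ) :
    pairAverage r G Λ z α ≤ (volume : Measure (Space d × Space d)).real (Λ ×ˢ Λ) := by
  have h := norm_setIntegral_le_of_norm_le_const (C := 1)
    (f := fun p => Real.exp (-pairExponent r G z α p)) (volume_prod_self_ne_top hΛ).lt_top
    (fun p _ => exp_neg_pairExponent_le_one hz α p)
  rw [one_mul] at h
  exact (le_abs_self _).trans h

theorem tendsto_pairAverage [IsFiniteMeasure r] (hr : Integrable (fun s => |s|) r)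
    (hr2 : Integrable (fun s => s ^ 2) r) (hσ : 0 < ∫ s, s ^ 2 ∂r) (hG : Measurable G)
    (hGi : Integrable G) (hG2 : ¬ MemLp G 2) {Λ : Set (Space d)} (hΛ : IsCompact Λ) {α : ℝ}
    (hα : α ≠ 0) : Tendsto (fun z => pairAverage r G Λ z α) atTop (𝓝 0) := by
  have h : Tendsto (fun z => pairAverage r G Λ z α) atTop
      (𝓝 (∫ p in Λ ×ˢ Λ, (0 : ℝ))) := by
    refine tendsto_integral_filter_of_dominated_convergence (fun _ => 1)
      (Eventually.of_forall fun z => ?_) ?_ (integrableOn_const (volume_prod_self_ne_top hΛ)) ?_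
    · exact ((measurable_pairExponent hG z).comp
        (measurable_const.prodMk measurable_id)).neg.exp.aestronglyMeasurable
    · filter_upwards [eventually_ge_atTop 0] with z hz
      exact ae_of_all _ fun p => exp_neg_pairExponent_le_one hz α p
    · filter_upwards [ae_restrict_of_ae (ae_lintegral_sub_sq_eq_top hG hGi hG2)] with p hp
      exact Real.tendsto_exp_neg_atTop_nhds_zero.comp
        (tendsto_pairExponent hr hr2 hσ hG hGi hα hp)
  simpa using h

/-- The bound for the first absolute moment of the potential with interaction measure dominated
by `ρ`. -/
theorem tendsto_integral_sqrt_pairAverage [IsFiniteMeasure r] (hr : Integrable (fun s => |s|) r)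
    (hr2 : Integrable (fun s => s ^ 2) r) (hσ : 0 < ∫ s, s ^ 2 ∂r) (hG : Measurable G)
    (hGi : Integrable G) (hG2 : ¬ MemLp G 2) {Λ : Set (Space d)} (hΛ : IsCompact Λ)
    {ρ : Measure ℝ} [IsFiniteMeasure ρ] (hρ : ρ {0} = 0) :
    Tendsto (fun z => ∫ α, Real.sqrt (pairAverage r G Λ z α) ∂ρ) atTop (𝓝 0) := by
  have h : Tendsto (fun z => ∫ α, Real.sqrt (pairAverage r G Λ z α) ∂ρ) atTop
      (𝓝 (∫ _, (0 : ℝ) ∂ρ)) := by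
    refine tendsto_integral_filter_of_dominated_convergence
      (fun _ => Real.sqrt ((volume : Measure (Space d × Space d)).real (Λ ×ˢ Λ)))
      (Eventually.of_forall fun z => (measurable_pairAverage hG Λ z).sqrt.aestronglyMeasurable) ?_
      (integrable_const _) ?_
    · filter_upwards [eventually_ge_atTop 0] with z hz
      refine ae_of_all _ fun α => ?_
      rw [Real.norm_of_nonneg (Real.sqrt_nonneg _)]
      exact Real.sqrt_le_sqrt (pairAverage_le hΛ hz α)
    · have : ∀ᵐ α ∂ρ, α ≠ 0 := by
        rw [ae_iff]
        simpa using hρ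
      filter_upwards [this] with α hα
      have := (Real.continuous_sqrt.tendsto 0).comp
        (tendsto_pairAverage hr hr2 hσ hG hGi hG2 hΛ hα)
      rwa [Real.sqrt_zero] at this
  simpa using h

end

end

/-! ### The law of the convoluted Poisson noise -/

noncomputable section

variable {d : ℕ} {r : Measure ℝ} {G : Space d → ℝ} {P : Measure (TempDist d)} {z : ℝ}

theorem noiseCharFun_scaledPoissonChar [IsFiniteMeasure r] (hsymm : r.map (fun s => -s) = r)
    (φ : Space d → ℝ) : noiseCharFun (scaledPoissonChar r z) φ =
      ((Real.exp (-∫ u, poissonExponent r z (φ u)) : ℝ) : ℂ) := by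
  rw [noiseCharFun]
  simp_rw [scaledPoissonChar_eq hsymm]
  rw [integral_complex_ofReal, integral_neg, Complex.ofReal_exp]

theorem noiseCharFun_gaussianChar (v : ℝ) (φ : Space d → ℝ) : noiseCharFun (gaussianChar v) φ =
      ((Real.exp (-∫ u, v / 2 * φ u ^ 2) : ℝ) : ℂ) := by
  rw [noiseCharFun]
  simp_rw [gaussianChar_eq]
  rw [integral_complex_ofReal, integral_neg, Complex.ofReal_exp]

theorem IsConvolutedNoiseLaw.integral_cos [IsFiniteMeasure r] (hsymm : r.map (fun s => -s) = r)
    (hP : IsConvolutedNoiseLaw (scaledPoissonChar r z) G P) (f : 𝓢(Space d, ℝ)) :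
    ∫ ω, Real.cos (ω f) ∂P = Real.exp (-∫ u, poissonExponent r z (adjConv G f u)) := by
  have := hP.1
  have h := hP.2 f
  rw [noiseCharFun_scaledPoissonChar hsymm] at h
  have hm : Measurable fun ω : TempDist d => Complex.exp (Complex.I * ((ω f : ℝ) : ℂ)) :=
    Complex.measurable_exp.comp ((Complex.measurable_ofReal.comp (measurable_eval f)).const_mul _)
  have hi : Integrable (fun ω : TempDist d => Complex.exp (Complex.I * ((ω f : ℝ) : ℂ))) P :=
    Integrable.of_bound hm.aestronglyMeasurable 1 (ae_of_all _ fun ω => by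
      rw [mul_comm, Complex.norm_exp_ofReal_mul_I])
  have h2 := congrArg Complex.re h
  rw [Complex.ofReal_re] at h2
  rw [← h2]
  have h3 := integral_re hi
  simp only [RCLike.re_eq_complex_re] at h3
  rw [← h3]
  congr with ω
  rw [mul_comm, Complex.exp_ofReal_mul_I_re]

/-- `E|X(f)| ≤ √z E|s| ‖Ǧ * f‖₁`, so that `X(f)` converges in `L¹` if `f` approximates a Dirac
measure. -/
theorem IsConvolutedNoiseLaw.lintegral_enorm_le [IsProbabilityMeasure r]
    (hr : Integrable (fun s => |s|) r) (hsymm : r.map (fun s => -s) = r) (hz : 0 < z)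
    (hG : Measurable G) (hGi : Integrable G)
    (hP : IsConvolutedNoiseLaw (scaledPoissonChar r z) G P) (f : 𝓢(Space d, ℝ)) :
    ∫⁻ ω, ‖ω f‖ₑ ∂P ≤
      ENNReal.ofReal (Real.sqrt z * ∫ s, |s| ∂r) * ∫⁻ u, ‖adjConv G f u‖ₑ := by
  have := hP.1
  refine lintegral_enorm_le_of_integral_cos hr hz (measurable_eval f)
    (measurable_adjConv hG f.continuous.measurable)
    (integrable_adjConv hG hGi f.continuous.measurable f.integrable) fun t => ?_
  have h := hP.integral_cos hsymm (t • f)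
  simp_rw [adjConv_schwartz_smul, map_smul, smul_eq_mul] at h
  exact h

/-- The paths of the convoluted Poisson noise are functions `h(·, ω)` with a jointly measurable
`h`, and the characteristic function of `X(x) - X(y)` is the expected one. -/
theorem IsConvolutedNoiseLaw.exists_path [IsProbabilityMeasure r]
    (hr : Integrable (fun s => |s|) r) (hsymm : r.map (fun s => -s) = r) (hz : 0 < z)
    (hG : Measurable G) (hGi : Integrable G)
    (hP : IsConvolutedNoiseLaw (scaledPoissonChar r z) G P) :
    ∃ h : Space d × TempDist d → ℝ, Measurable h ∧ (∀ᵐ ω ∂P, IsGivenBy ω fun x => h (x, ω)) ∧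
      ∀ᵐ p : Space d × Space d, ∀ α : ℝ, ∫ ω, Real.cos (α * (h (p.1, ω) - h (p.2, ω))) ∂P =
        Real.exp (-pairExponent r G z α p) := by
  have := hP.1
  have hb := hP.lintegral_enorm_le hr hsymm hz hG hGi
  obtain ⟨hmem, h, hm, hi, hlim⟩ := exists_tendsto_approxPath hG hGi ENNReal.ofReal_ne_top hb
  refine ⟨h, hm, ae_isGivenBy hG hGi ENNReal.ofReal_ne_top hb hmem hm hi hlim, ?_⟩
  -- along a subsequence, the approximations converge for almost all `(x, ω)`
  obtain ⟨ns, hns, hae⟩ := (tendstoInMeasure_of_tendsto_eLpNorm one_ne_zero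
    (fun n => (hmem n).1) hi.1 hlim).exists_seq_tendsto_ae
  have hae' : ∀ᵐ x : Space d, ∀ᵐ ω ∂P,
      Tendsto (fun i => approxPath d (ns i) (x, ω)) atTop (𝓝 (h (x, ω))) :=
    volume_absolutelyContinuous_weightMeasure.ae_le (Measure.ae_ae_of_ae_prod hae)
  filter_upwards [Measure.quasiMeasurePreserving_fst.ae hae',
    Measure.quasiMeasurePreserving_snd.ae hae'] with p hp1 hp2 α
  -- the left-hand side is the limit for the approximations
  have t1 : Tendsto (fun i => ∫ ω, Real.cos (α * (approxPath d (ns i) (p.1, ω) -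
      approxPath d (ns i) (p.2, ω))) ∂P) atTop
      (𝓝 (∫ ω, Real.cos (α * (h (p.1, ω) - h (p.2, ω))) ∂P)) := by
    refine tendsto_integral_of_dominated_convergence (fun _ => 1) (fun i => ?_)
      (integrable_const _) (fun i => ae_of_all _ fun ω => Real.abs_cos_le_one _) ?_
    · have (x : Space d) : Measurable fun ω => approxPath d (ns i) (x, ω) :=
        (measurable_approxPath (ns i)).comp (measurable_const.prodMk measurable_id)
      exact (((this p.1).sub (this p.2)).const_mul α).cos.aestronglyMeasurable
    · filter_upwards [hp1, hp2] with ω hω1 hω2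
      exact (Real.continuous_cos.tendsto _).comp ((hω1.sub hω2).const_mul α)
  -- so is the right-hand side
  have e1 (i : ℕ) : ∫ ω, Real.cos (α * (approxPath d (ns i) (p.1, ω) -
      approxPath d (ns i) (p.2, ω))) ∂P = Real.exp (-∫ u, poissonExponent r z
        (α * (adjConv G (approxDirac d (ns i) p.1) u - adjConv G (approxDirac d (ns i) p.2) u))) := by
    have h1 := hP.integral_cos hsymm
      (α • (approxDirac d (ns i) p.1 - approxDirac d (ns i) p.2))
    have h2 (u : Space d) : adjConv G (approxDirac d (ns i) p.1 - approxDirac d (ns i) p.2 :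
        𝓢(Space d, ℝ)) u = adjConv G (approxDirac d (ns i) p.1) u -
          adjConv G (approxDirac d (ns i) p.2) u :=
      (adjConvLin hGi u).map_sub _ _
    simp_rw [adjConv_schwartz_smul, map_smul, map_sub, smul_eq_mul, h2] at h1
    exact h1
  have hdi (i : ℕ) (x : Space d) : Integrable (adjConv G (approxDirac d (ns i) x)) :=
    integrable_adjConv hG hGi (approxDirac d (ns i) x).continuous.measurable
      (approxDirac d (ns i) x).integrable
  have t2 : Tendsto (fun i => ∫ u, poissonExponent r z
        (α * (adjConv G (approxDirac d (ns i) p.1) u - adjConv G (approxDirac d (ns i) p.2) u)))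
      atTop (𝓝 (pairExponent r G z α p)) := by
    refine tendsto_integral_of_L1 _ (integrable_pairExponent hr hz hGi α p).1
      (Eventually.of_forall fun i => integrable_poissonExponent_comp hr hz
        (((hdi i p.1).sub (hdi i p.2)).const_mul α)) ?_
    have h0 : Tendsto (fun i => ENNReal.ofReal (Real.sqrt z * (∫ s, |s| ∂r) * |α|) *
        (approxError G (ns i) p.1 + approxError G (ns i) p.2)) atTop (𝓝 0) := by
      have := ENNReal.Tendsto.const_mul (a := ENNReal.ofReal (Real.sqrt z * (∫ s, |s| ∂r) * |α|))
        (((tendsto_approxError hG hGi p.1).comp hns.tendsto_atTop).add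
          ((tendsto_approxError hG hGi p.2).comp hns.tendsto_atTop)) (Or.inr ENNReal.ofReal_ne_top)
      simpa using this
    refine tendsto_of_tendsto_of_tendsto_of_le_of_le tendsto_const_nhds h0 (fun _ => zero_le)
      fun i => ?_
    simp only
    have hma (x : Space d) : Measurable fun u =>
        ‖adjConv G (approxDirac d (ns i) x) u - G (x - u)‖ₑ :=
      ((measurable_adjConv hG (approxDirac d (ns i) x).continuous.measurable).sub
        (by fun_prop)).enorm
    rw [approxError, approxError, ← lintegral_add_left (hma p.1),
      ← lintegral_const_mul' _ _ ENNReal.ofReal_ne_top]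
    refine lintegral_mono fun u => ?_
    set a := adjConv G (approxDirac d (ns i) p.1) u
    set b := adjConv G (approxDirac d (ns i) p.2) u
    have h4 : 0 ≤ Real.sqrt z * (∫ s, |s| ∂r) :=
      mul_nonneg (Real.sqrt_nonneg z) (integral_nonneg fun _ => abs_nonneg _)
    simp only [Real.enorm_eq_ofReal_abs]
    rw [← ENNReal.ofReal_add (abs_nonneg _) (abs_nonneg _),
      ← ENNReal.ofReal_mul (mul_nonneg h4 (abs_nonneg _))]
    refine ENNReal.ofReal_le_ofReal ((abs_poissonExponent_sub_le hr hz _ _).trans ?_)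
    rw [← mul_sub, abs_mul, ← mul_assoc]
    refine mul_le_mul_of_nonneg_left ?_ (mul_nonneg h4 (abs_nonneg _))
    rw [sub_sub_sub_comm]
    exact abs_sub _ _
  refine tendsto_nhds_unique t1 ?_
  simp_rw [e1]
  exact (Real.continuous_exp.tendsto _).comp t2.neg

end

/-! ### The energy density as an integral against positive measures -/

noncomputable section

variable {d : ℕ}

section EnergyDensity

variable (ν : ComplexMeasure ℝ)

/-- The total variation of the real part of the interaction measure. The energy density is a real
part, so that the imaginary part of the interaction measure does not contribute to it. -/
def interactionVariation : Measure ℝ := (ComplexMeasure.re ν).totalVariation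

/-- The positive part of the real part of the interaction measure. -/
def interactionPos : Measure ℝ := (ComplexMeasure.re ν).toJordanDecomposition.posPart

/-- The negative part of the real part of the interaction measure. -/
def interactionNeg : Measure ℝ := (ComplexMeasure.re ν).toJordanDecomposition.negPart

instance : IsFiniteMeasure (interactionPos ν) :=
  (ComplexMeasure.re ν).toJordanDecomposition.posPart_finite

instance : IsFiniteMeasure (interactionNeg ν) :=
  (ComplexMeasure.re ν).toJordanDecomposition.negPart_finite

theorem interactionVariation_eq : interactionVariation ν = interactionPos ν + interactionNeg ν := rfl

instance : IsFiniteMeasure (interactionVariation ν) := by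
  rw [interactionVariation_eq]
  infer_instance

theorem re_apply_eq {s : Set ℝ} (hs : MeasurableSet s) :
    (ν s).re = (interactionPos ν).real s - (interactionNeg ν).real s :=
  (ComplexMeasure.re ν).apply_eq_posPart_real_sub_negPart_real hs

theorem interactionVariation_singleton_zero (hν : ν {0} = 0) : interactionVariation ν {0} = 0 := by
  have h := re_apply_eq ν (measurableSet_singleton 0)
  rw [hν, Complex.zero_re] at h
  have hz {μ : Measure ℝ} [IsFiniteMeasure μ] : μ.real {0} = 0 ↔ μ {0} = 0 :=
    measureReal_eq_zero_iff
  rw [interactionVariation_eq, Measure.add_apply, add_eq_zero]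
  obtain ⟨S, -, h1, h2⟩ := (ComplexMeasure.re ν).toJordanDecomposition.mutuallySingular
  by_cases h0 : (0 : ℝ) ∈ S
  · have hp : interactionPos ν {0} = 0 := measure_mono_null (Set.singleton_subset_iff.2 h0) h1
    refine ⟨hp, hz.1 ?_⟩
    rw [hz.2 hp] at h
    linarith
  · have hq : interactionNeg ν {0} = 0 := measure_mono_null (Set.singleton_subset_iff.2 h0) h2
    refine ⟨hz.1 ?_, hq⟩
    rw [hz.2 hq] at h
    linarith

instance : IsFiniteMeasure ν.variation := by
  have h : ν.variation ≤ (ComplexMeasure.re ν).totalVariation +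
      (ComplexMeasure.im ν).totalVariation := by
    refine VectorMeasure.variation_le_of_forall_enorm_le fun s _ => ?_
    rw [Measure.add_apply]
    refine le_trans ?_ (add_le_add ((ComplexMeasure.re ν).enorm_le_totalVariation s)
      ((ComplexMeasure.im ν).enorm_le_totalVariation s))
    change ‖ν s‖ₑ ≤ ‖(ν s).re‖ₑ + ‖(ν s).im‖ₑ
    rw [← ofReal_norm, ← ofReal_norm, ← ofReal_norm,
      ← ENNReal.ofReal_add (norm_nonneg _) (norm_nonneg _)]
    exact ENNReal.ofReal_le_ofReal (Complex.norm_le_abs_re_add_abs_im _)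
  have : IsFiniteMeasure ((ComplexMeasure.re ν).totalVariation +
      (ComplexMeasure.im ν).totalVariation) := by
    unfold SignedMeasure.totalVariation
    infer_instance
  exact isFiniteMeasure_of_le _ h

/-- The real part of the integral against a complex measure is the integral against the real
part of the measure. -/
theorem re_integral_eq {f : ℝ → ℝ} (hfm : Measurable f) {C : ℝ} (hC : ∀ x, ‖f x‖ ≤ C) :
    (VectorMeasure.integral ν f (ContinuousLinearMap.lsmul ℝ ℝ)).re =
      ∫ x, f x ∂(interactionPos ν) - ∫ x, f x ∂(interactionNeg ν) := by
  -- both sides are continuous in `L¹` of a common dominating measure, and agree for indicators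
  let μ : Measure ℝ := ν.variation + interactionPos ν + interactionNeg ν
  have hν1 : ν.variation ≤ μ := Measure.le_add_right (Measure.le_add_right le_rfl)
  have hp1 : interactionPos ν ≤ μ := Measure.le_add_right (Measure.le_add_left le_rfl)
  have hq1 : interactionNeg ν ≤ μ := Measure.le_add_left le_rfl
  have hf : Integrable f μ := Integrable.of_bound hfm.aestronglyMeasurable C (ae_of_all _ hC)
  refine Integrable.induction (μ := μ)
    (fun f => (VectorMeasure.integral ν f (ContinuousLinearMap.lsmul ℝ ℝ)).re =
      ∫ x, f x ∂(interactionPos ν) - ∫ x, f x ∂(interactionNeg ν)) ?_ ?_ ?_ ?_ hf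
  · intro c s hs _
    rw [VectorMeasure.integral_indicator hs, VectorMeasure.integral_const, integral_indicator hs,
      integral_indicator hs, setIntegral_const, setIntegral_const, ← sub_smul, ← re_apply_eq ν hs,
      VectorMeasure.restrict_apply _ hs MeasurableSet.univ, Set.univ_inter]
    simp [mul_comm]
  · intro f g _ hf hg hf' hg'
    rw [VectorMeasure.integral_add (hf.mono_measure hν1) (hg.mono_measure hν1), Complex.add_re, hf',
      hg', integral_add' (hf.mono_measure hp1) (hg.mono_measure hp1),
      integral_add' (hf.mono_measure hq1) (hg.mono_measure hq1)]
    ring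
  · refine IsSeqClosed.isClosed fun F g hF hg => ?_
    rw [tendsto_iff_edist_tendsto_0] at hg
    have hL1 : Tendsto (fun n => ∫⁻ x, ‖F n x - g x‖ₑ ∂μ) atTop (𝓝 0) := by
      refine hg.congr fun n => ?_
      rw [Lp.edist_def, eLpNorm_one_eq_lintegral_enorm]
      rfl
    have hle {m : Measure ℝ} (hm : m ≤ μ) :
        Tendsto (fun n => ∫⁻ x, ‖F n x - g x‖ₑ ∂m) atTop (𝓝 0) :=
      tendsto_of_tendsto_of_tendsto_of_le_of_le tendsto_const_nhds hL1 (fun _ => zero_le)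
        fun n => lintegral_mono' hm le_rfl
    have hi (F : ℝ →₁[μ] ℝ) : Integrable F μ := L1.integrable_coeFn F
    have t1 := VectorMeasure.tendsto_integral_of_L1 (B := ContinuousLinearMap.lsmul ℝ ℝ) (μ := ν) g
      ((hi g).mono_measure hν1).1 (Eventually.of_forall fun n => (hi (F n)).mono_measure hν1)
      (hle hν1)
    have t2 := tendsto_integral_of_L1 g ((hi g).mono_measure hp1).1
      (Eventually.of_forall fun n => (hi (F n)).mono_measure hp1) (hle hp1)
    have t3 := tendsto_integral_of_L1 g ((hi g).mono_measure hq1).1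
      (Eventually.of_forall fun n => (hi (F n)).mono_measure hq1) (hle hq1)
    refine tendsto_nhds_unique ((Complex.continuous_re.tendsto _).comp t1) ?_
    exact (t2.sub t3).congr fun n => (hF n).symm
  · intro f g hfg _ hf
    rw [← VectorMeasure.integral_congr_ae (hν1.absolutelyContinuous.ae_le hfg), hf,
      integral_congr_ae (hp1.absolutelyContinuous.ae_le hfg),
      integral_congr_ae (hq1.absolutelyContinuous.ae_le hfg)]

theorem trigDensity_eq (t : ℝ) : trigDensity ν t =
    ∫ α, Real.cos (α * t) ∂(interactionPos ν) - ∫ α, Real.cos (α * t) ∂(interactionNeg ν) :=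
  re_integral_eq ν (by fun_prop) fun _ => Real.abs_cos_le_one _

theorem abs_trigDensity_le (t : ℝ) :
    |trigDensity ν t| ≤ (interactionVariation ν).real Set.univ := by
  have h (μ : Measure ℝ) [IsFiniteMeasure μ] : |∫ α, Real.cos (α * t) ∂μ| ≤ μ.real Set.univ := by
    simpa using norm_integral_le_of_norm_le_const (μ := μ) (f := fun α => Real.cos (α * t))
      (ae_of_all _ fun α => Real.abs_cos_le_one _)
  rw [trigDensity_eq, interactionVariation_eq, measureReal_add_apply]
  exact (abs_sub _ _).trans (add_le_add (h _) (h _))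

theorem measurable_trigDensity : Measurable (trigDensity ν) := by
  have hm : Measurable fun q : ℝ × ℝ => Real.cos (q.2 * q.1) := by fun_prop
  have h : trigDensity ν = fun t => ∫ α, Real.cos (α * t) ∂(interactionPos ν) -
      ∫ α, Real.cos (α * t) ∂(interactionNeg ν) := funext (trigDensity_eq ν)
  rw [h]
  exact (hm.stronglyMeasurable.integral_prod_right' (ν := interactionPos ν)).measurable.sub
    (hm.stronglyMeasurable.integral_prod_right' (ν := interactionNeg ν)).measurable

end EnergyDensity

/-! ### The first absolute moment of the potential -/

section Potential

variable {Ω : Type*} [MeasurableSpace Ω] {P : Measure Ω} [IsProbabilityMeasure P]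
  {r : Measure ℝ} {G : Space d → ℝ} {z : ℝ} {Λ : Set (Space d)} {h : Space d × Ω → ℝ}

/-- With a sine term added, `(∫_Λ cos (α h))²` becomes the integral of `cos (α (h(x) - h(y)))`,
whose expectation is known. -/
theorem lintegral_sq_integral_cos_le (hΛ : IsCompact Λ) (hm : Measurable h)
    (hpair : ∀ᵐ p : Space d × Space d, ∀ α : ℝ,
      ∫ ω, Real.cos (α * (h (p.1, ω) - h (p.2, ω))) ∂P = Real.exp (-pairExponent r G z α p))
    (α : ℝ) : ∫⁻ ω, ‖∫ x in Λ, Real.cos (α * h (x, ω))‖ₑ ^ 2 ∂P ≤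
      ENNReal.ofReal (pairAverage r G Λ z α) := by
  have hfin : IsFiniteMeasure (volume.restrict Λ) := ⟨by
    simpa using hΛ.measure_lt_top⟩
  have hmp : Measurable fun q : Ω × Space d × Space d =>
      Real.cos (α * (h (q.2.1, q.1) - h (q.2.2, q.1))) := by fun_prop
  have hsq (ω : Ω) : (∫ x in Λ, Real.cos (α * h (x, ω))) ^ 2 ≤
      ∫ p in Λ ×ˢ Λ, Real.cos (α * (h (p.1, ω) - h (p.2, ω))) := by
    have hc : Measurable fun x => Real.cos (α * h (x, ω)) := by fun_prop
    have hs : Measurable fun x => Real.sin (α * h (x, ω)) := by fun_prop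
    have hci : Integrable (fun x => Real.cos (α * h (x, ω))) (volume.restrict Λ) :=
      Integrable.of_bound hc.aestronglyMeasurable 1 (ae_of_all _ fun _ => Real.abs_cos_le_one _)
    have hsi : Integrable (fun x => Real.sin (α * h (x, ω))) (volume.restrict Λ) :=
      Integrable.of_bound hs.aestronglyMeasurable 1 (ae_of_all _ fun _ => Real.abs_sin_le_one _)
    have e : ∫ p in Λ ×ˢ Λ, Real.cos (α * (h (p.1, ω) - h (p.2, ω))) =
        (∫ x in Λ, Real.cos (α * h (x, ω))) ^ 2 + (∫ x in Λ, Real.sin (α * h (x, ω))) ^ 2 := by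
      simp_rw [mul_sub, Real.cos_sub]
      rw [Measure.volume_eq_prod, ← Measure.prod_restrict,
        integral_add (hci.mul_prod hci) (hsi.mul_prod hsi),
        integral_prod_mul (fun x => Real.cos (α * h (x, ω))) (fun x => Real.cos (α * h (x, ω))),
        integral_prod_mul (fun x => Real.sin (α * h (x, ω))) (fun x => Real.sin (α * h (x, ω))),
        sq, sq]
    rw [e]
    exact le_add_of_nonneg_right (sq_nonneg _)
  have hfin2 : IsFiniteMeasure ((volume : Measure (Space d × Space d)).restrict (Λ ×ˢ Λ)) := ⟨by
    simpa using (volume_prod_self_ne_top hΛ).lt_top⟩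
  have hF0 (ω : Ω) : 0 ≤ ∫ p in Λ ×ˢ Λ, Real.cos (α * (h (p.1, ω) - h (p.2, ω))) :=
    (sq_nonneg _).trans (hsq ω)
  have hii : Integrable (fun q : Ω × Space d × Space d =>
      Real.cos (α * (h (q.2.1, q.1) - h (q.2.2, q.1)))) (P.prod (volume.restrict (Λ ×ˢ Λ))) :=
    Integrable.of_bound hmp.aestronglyMeasurable 1 (ae_of_all _ fun _ => Real.abs_cos_le_one _)
  calc ∫⁻ ω, ‖∫ x in Λ, Real.cos (α * h (x, ω))‖ₑ ^ 2 ∂P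
      ≤ ∫⁻ ω, ENNReal.ofReal (∫ p in Λ ×ˢ Λ, Real.cos (α * (h (p.1, ω) - h (p.2, ω)))) ∂P := by
        refine lintegral_mono fun ω => ?_
        rw [Real.enorm_eq_ofReal_abs, ← ENNReal.ofReal_pow (abs_nonneg _), sq_abs]
        exact ENNReal.ofReal_le_ofReal (hsq ω)
    _ = ENNReal.ofReal (∫ ω, (∫ p in Λ ×ˢ Λ, Real.cos (α * (h (p.1, ω) - h (p.2, ω)))) ∂P) :=
        (ofReal_integral_eq_lintegral_ofReal hii.integral_prod_left (ae_of_all _ hF0)).symm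
    _ = ENNReal.ofReal (pairAverage r G Λ z α) := by
        rw [integral_integral_swap hii, pairAverage]
        congr 1
        refine integral_congr_ae ?_
        filter_upwards [ae_restrict_of_ae hpair] with p hp
        exact hp α

theorem lintegral_enorm_integral_cos_le (hΛ : IsCompact Λ) (hm : Measurable h)
    (hpair : ∀ᵐ p : Space d × Space d, ∀ α : ℝ,
      ∫ ω, Real.cos (α * (h (p.1, ω) - h (p.2, ω))) ∂P = Real.exp (-pairExponent r G z α p))
    (α : ℝ) : ∫⁻ ω, ‖∫ x in Λ, Real.cos (α * h (x, ω))‖ₑ ∂P ≤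
      ENNReal.ofReal (Real.sqrt (pairAverage r G Λ z α)) := by
  have hmC : Measurable fun ω => ∫ x in Λ, Real.cos (α * h (x, ω)) := by
    have : Measurable fun q : Ω × Space d => Real.cos (α * h (q.2, q.1)) := by fun_prop
    exact (this.stronglyMeasurable.integral_prod_right' (ν := volume.restrict Λ)).measurable
  refine (ENNReal.pow_le_pow_left_iff two_ne_zero).1 ?_
  rw [← ENNReal.ofReal_pow (Real.sqrt_nonneg _), Real.sq_sqrt (pairAverage_nonneg _ _ _)]
  refine (sq_lintegral_le P hmC.enorm.aemeasurable).trans ?_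
  rw [measure_univ, one_mul]
  exact lintegral_sq_integral_cos_le hΛ hm hpair α

/-- The first absolute moment of the potential is controlled by the two-point functions. -/
theorem lintegral_enorm_integral_trigDensity_le [SFinite r] (hG : Measurable G)
    (ν : ComplexMeasure ℝ) (hz : 0 ≤ z) (hΛ : IsCompact Λ) (hm : Measurable h)
    (hpair : ∀ᵐ p : Space d × Space d, ∀ α : ℝ,
      ∫ ω, Real.cos (α * (h (p.1, ω) - h (p.2, ω))) ∂P = Real.exp (-pairExponent r G z α p)) :
    ∫⁻ ω, ‖∫ x in Λ, trigDensity ν (h (x, ω))‖ₑ ∂P ≤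
      ENNReal.ofReal (∫ α, Real.sqrt (pairAverage r G Λ z α) ∂(interactionVariation ν)) := by
  have hfin : IsFiniteMeasure (volume.restrict Λ) := ⟨by
    simpa using hΛ.measure_lt_top⟩
  have hmC : Measurable fun q : Ω × ℝ => ∫ x in Λ, Real.cos (q.2 * h (x, q.1)) := by
    have : Measurable fun q : (Ω × ℝ) × Space d => Real.cos (q.1.2 * h (q.2, q.1.1)) := by fun_prop
    exact (this.stronglyMeasurable.integral_prod_right' (ν := volume.restrict Λ)).measurable
  have hswap (μ : Measure ℝ) [IsFiniteMeasure μ] (ω : Ω) :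
      Integrable (fun x => ∫ α, Real.cos (α * h (x, ω)) ∂μ) (volume.restrict Λ) ∧
      ∫ x in Λ, ∫ α, Real.cos (α * h (x, ω)) ∂μ =
        ∫ α, (∫ x in Λ, Real.cos (α * h (x, ω))) ∂μ := by
    have hmc : Measurable fun q : Space d × ℝ => Real.cos (q.2 * h (q.1, ω)) := by fun_prop
    have hi : Integrable (fun q : Space d × ℝ => Real.cos (q.2 * h (q.1, ω)))
        ((volume.restrict Λ).prod μ) :=
      Integrable.of_bound hmc.aestronglyMeasurable 1 (ae_of_all _ fun _ => Real.abs_cos_le_one _)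
    exact ⟨hi.integral_prod_left, integral_integral_swap hi⟩
  have h1 (ω : Ω) : ‖∫ x in Λ, trigDensity ν (h (x, ω))‖ₑ ≤
      ∫⁻ α, ‖∫ x in Λ, Real.cos (α * h (x, ω))‖ₑ ∂(interactionVariation ν) := by
    simp_rw [trigDensity_eq]
    rw [integral_sub (hswap _ ω).1 (hswap _ ω).1, (hswap _ ω).2, (hswap _ ω).2,
      interactionVariation_eq, lintegral_add_measure]
    exact enorm_sub_le.trans (add_le_add (enorm_integral_le_lintegral_enorm _)
      (enorm_integral_le_lintegral_enorm _))
  calc ∫⁻ ω, ‖∫ x in Λ, trigDensity ν (h (x, ω))‖ₑ ∂P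
      ≤ ∫⁻ ω, ∫⁻ α, ‖∫ x in Λ, Real.cos (α * h (x, ω))‖ₑ ∂(interactionVariation ν) ∂P :=
        lintegral_mono h1
    _ = ∫⁻ α, ∫⁻ ω, ‖∫ x in Λ, Real.cos (α * h (x, ω))‖ₑ ∂P ∂(interactionVariation ν) :=
        lintegral_lintegral_swap hmC.enorm.aemeasurable
    _ ≤ ∫⁻ α, ENNReal.ofReal (Real.sqrt (pairAverage r G Λ z α)) ∂(interactionVariation ν) :=
        lintegral_mono fun α => lintegral_enorm_integral_cos_le hΛ hm hpair α
    _ = _ := by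
        refine (ofReal_integral_eq_lintegral_ofReal ?_ (ae_of_all _ fun _ => Real.sqrt_nonneg _)).symm
        refine Integrable.of_bound (measurable_pairAverage hG Λ z).sqrt.aestronglyMeasurable
          (Real.sqrt ((volume : Measure (Space d × Space d)).real (Λ ×ˢ Λ)))
          (ae_of_all _ fun α => ?_)
        rw [Real.norm_of_nonneg (Real.sqrt_nonneg _)]
        exact Real.sqrt_le_sqrt (pairAverage_le hΛ hz α)

theorem abs_potential_le (hΛ : IsCompact Λ) (ν : ComplexMeasure ℝ) (ω : TempDist d) :
    |potential (trigDensity ν) Λ ω| ≤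
      (interactionVariation ν).real Set.univ * volume.real Λ := by
  rw [potential]
  split_ifs with H
  · rw [← Real.norm_eq_abs]
    refine norm_setIntegral_le_of_norm_le_const hΛ.measure_lt_top fun x _ => ?_
    rw [Real.norm_eq_abs]
    exact abs_trigDensity_le ν _
  · rw [abs_zero]
    positivity

end Potential

end

/-! ### Gibbs modifications by a bounded potential -/

noncomputable section

variable {d : ℕ}

theorem abs_exp_sub_one_le_abs_mul_exp (x : ℝ) : |Real.exp x - 1| ≤ |x| * Real.exp |x| := by
  have h1 := Real.add_one_le_exp x
  have h2 := Real.add_one_le_exp (-x)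
  have h3 : Real.exp (-x) * Real.exp x = 1 := by rw [← Real.exp_add]; simp
  have h4 := Real.exp_pos x
  rcases le_total 0 x with hx | hx
  · rw [abs_of_nonneg hx, abs_of_nonneg (by linarith)]
    nlinarith
  · rw [abs_of_nonpos hx, abs_of_nonpos (by linarith [Real.exp_le_one_iff.2 hx])]
    nlinarith [Real.exp_pos (-x)]

section Gibbs

variable {P : Measure (TempDist d)} [IsProbabilityMeasure P] {V : TempDist d → ℝ} {M β : ℝ}

theorem integrable_exp_of_bound (hV : AEMeasurable V P) (hM : ∀ ω, |V ω| ≤ M) (hβ : 0 < β) :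
    Integrable (fun ω => Real.exp (-β * V ω)) P := by
  refine Integrable.of_bound (hV.const_mul (-β)).exp.aestronglyMeasurable (Real.exp (β * M))
    (ae_of_all _ fun ω => ?_)
  rw [Real.norm_of_nonneg (Real.exp_pos _).le, Real.exp_le_exp]
  nlinarith [neg_abs_le (V ω), hM ω]

theorem exp_le_partitionFunction (hV : AEMeasurable V P) (hM : ∀ ω, |V ω| ≤ M) (hβ : 0 < β) :
    Real.exp (-(β * M)) ≤ partitionFunction β V P := by
  have h := integral_mono (μ := P) (integrable_const (Real.exp (-(β * M))))
    (integrable_exp_of_bound hV hM hβ) fun ω => by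
      rw [Real.exp_le_exp]
      nlinarith [le_abs_self (V ω), hM ω]
  rw [integral_const, probReal_univ, one_smul] at h
  exact h

theorem partitionFunction_pos (hV : AEMeasurable V P) (hM : ∀ ω, |V ω| ≤ M) (hβ : 0 < β) :
    0 < partitionFunction β V P :=
  (Real.exp_pos _).trans_le (exp_le_partitionFunction hV hM hβ)

theorem isProbabilityMeasure_interactingLaw (hV : AEMeasurable V P) (hM : ∀ ω, |V ω| ≤ M)
    (hβ : 0 < β) : IsProbabilityMeasure (interactingLaw β V P) := by
  have hΞ := partitionFunction_pos hV hM hβ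
  refine ⟨?_⟩
  rw [interactingLaw, withDensity_apply _ MeasurableSet.univ, Measure.restrict_univ,
    ← ofReal_integral_eq_lintegral_ofReal ((integrable_exp_of_bound hV hM hβ).div_const _)
      (ae_of_all _ fun ω => (div_pos (Real.exp_pos _) hΞ).le), integral_div]
  change ENNReal.ofReal (partitionFunction β V P / partitionFunction β V P) = 1
  rw [div_self hΞ.ne', ENNReal.ofReal_one]

/-- The Gibbs factor of a bounded potential changes expectations of bounded functions by at most a
multiple of the first absolute moment of the potential. -/
theorem abs_integral_interactingLaw_sub_le (hV : AEMeasurable V P) (hM : ∀ ω, |V ω| ≤ M)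
    (hβ : 0 < β) {φ : TempDist d → ℝ} (hφ : Measurable φ) {C : ℝ} (hC : ∀ ω, |φ ω| ≤ C) :
    |∫ ω, φ ω ∂(interactingLaw β V P) - ∫ ω, φ ω ∂P| ≤
      2 * C * β * Real.exp (2 * (β * M)) * ∫ ω, |V ω| ∂P := by
  have hΞ := partitionFunction_pos hV hM hβ
  have hC0 : 0 ≤ C := by
    obtain ⟨ω⟩ := (inferInstance : Nonempty (TempDist d))
    exact (abs_nonneg _).trans (hC ω)
  have hVi : Integrable V P := Integrable.of_bound hV.aestronglyMeasurable M (ae_of_all _ hM)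
  have hEi := integrable_exp_of_bound hV hM hβ
  have hφi : Integrable φ P := Integrable.of_bound hφ.aestronglyMeasurable C (ae_of_all _ hC)
  set Ξ := partitionFunction β V P with hΞdef
  have hVexp (ω : TempDist d) :
      |Real.exp (-β * V ω) - 1| ≤ β * Real.exp (β * M) * |V ω| := by
    refine (abs_exp_sub_one_le_abs_mul_exp _).trans ?_
    have h1 : |-β * V ω| = β * |V ω| := by rw [abs_mul, abs_neg, abs_of_pos hβ]
    rw [h1]
    have h2 : Real.exp (β * |V ω|) ≤ Real.exp (β * M) := by
      rw [Real.exp_le_exp]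
      exact mul_le_mul_of_nonneg_left (hM ω) hβ.le
    calc β * |V ω| * Real.exp (β * |V ω|) ≤ β * |V ω| * Real.exp (β * M) := by gcongr
      _ = _ := by ring
  have hDi : Integrable (fun ω => |Real.exp (-β * V ω) - 1|) P :=
    (hEi.sub (integrable_const 1)).abs
  have hD : ∫ ω, |Real.exp (-β * V ω) - 1| ∂P ≤ β * Real.exp (β * M) * ∫ ω, |V ω| ∂P := by
    rw [← integral_const_mul]
    exact integral_mono hDi (hVi.abs.const_mul _) hVexp
  have hΞ1 : |1 - Ξ| ≤ ∫ ω, |Real.exp (-β * V ω) - 1| ∂P := by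
    have : Ξ - 1 = ∫ ω, (Real.exp (-β * V ω) - 1) ∂P := by
      rw [integral_sub hEi (integrable_const 1)]
      simp [hΞdef, partitionFunction]
    rw [abs_sub_comm, this]
    exact abs_integral_le_integral_abs
  have e1 : ∫ ω, φ ω ∂(interactingLaw β V P) = ∫ ω, Real.exp (-β * V ω) / Ξ * φ ω ∂P := by
    rw [interactingLaw, integral_withDensity_eq_integral_toReal_smul₀
      (hEi.1.aemeasurable.div_const _).ennreal_ofReal (ae_of_all _ fun _ => ENNReal.ofReal_lt_top)]
    refine integral_congr_ae (ae_of_all _ fun ω => ?_)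
    simp only [smul_eq_mul]
    rw [ENNReal.toReal_ofReal (div_pos (Real.exp_pos _) hΞ).le]
  have hi1 : Integrable (fun ω => Real.exp (-β * V ω) / Ξ * φ ω) P :=
    (hEi.div_const _).mul_bdd hφ.aestronglyMeasurable (ae_of_all _ hC)
  have hbd : Integrable (fun ω => C / Ξ * (|Real.exp (-β * V ω) - 1| + |1 - Ξ|)) P :=
    (hDi.add (integrable_const _)).const_mul _
  rw [e1, ← integral_sub hi1 hφi]
  calc |∫ ω, (Real.exp (-β * V ω) / Ξ * φ ω - φ ω) ∂P|
      ≤ ∫ ω, C / Ξ * (|Real.exp (-β * V ω) - 1| + |1 - Ξ|) ∂P := by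
        rw [← Real.norm_eq_abs]
        refine norm_integral_le_of_norm_le hbd (ae_of_all _ fun ω => ?_)
        have : Real.exp (-β * V ω) / Ξ * φ ω - φ ω =
            φ ω / Ξ * ((Real.exp (-β * V ω) - 1) + (1 - Ξ)) := by
          field_simp
          ring
        rw [this, Real.norm_eq_abs, abs_mul, abs_div, abs_of_pos hΞ]
        gcongr
        · exact hC ω
        · exact abs_add_le _ _
    _ = C / Ξ * ((∫ ω, |Real.exp (-β * V ω) - 1| ∂P) + |1 - Ξ|) := by
        rw [integral_const_mul, integral_add hDi (integrable_const _)]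
        simp
    _ ≤ C * Real.exp (β * M) * (2 * (β * Real.exp (β * M) * ∫ ω, |V ω| ∂P)) := by
        have h5 : C / Ξ ≤ C * Real.exp (β * M) := by
          rw [div_le_iff₀ hΞ]
          have h6 := mul_le_mul_of_nonneg_left (exp_le_partitionFunction hV hM hβ)
            (Real.exp_pos (β * M)).le
          rw [← Real.exp_add, add_neg_cancel, Real.exp_zero] at h6
          calc C = C * 1 := (mul_one C).symm
            _ ≤ C * (Real.exp (β * M) * Ξ) := mul_le_mul_of_nonneg_left h6 hC0
            _ = _ := by ring
        refine mul_le_mul h5 (by linarith) ?_ (by positivity)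
        exact add_nonneg (integral_nonneg fun _ => abs_nonneg _) (abs_nonneg _)
    _ = _ := by
        rw [two_mul (β * M), Real.exp_add]
        ring

end Gibbs

/-! ### Convergence of the free fields -/

section Free

variable {G : Space d → ℝ} {r : Measure ℝ}

/-- The joint law of `ω(f₁), …, ω(fₙ)`, on the Euclidean space since characteristic functions are
defined by the inner product. -/
def jointLaw {n : ℕ} (f : Fin n → 𝓢(Space d, ℝ)) (P : Measure (TempDist d)) :
    Measure (EuclideanSpace ℝ (Fin n)) := P.map fun ω => WithLp.toLp 2 fun i => ω (f i)

theorem measurable_toLp_eval {n : ℕ} (f : Fin n → 𝓢(Space d, ℝ)) :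
    Measurable fun ω : TempDist d => WithLp.toLp 2 fun i => ω (f i) :=
  (WithLp.measurable_toLp 2 (Fin n → ℝ)).comp
    (measurable_pi_lambda _ fun i => measurable_eval (f i))

theorem charFun_jointLaw {ψ : ℝ → ℂ} {P : Measure (TempDist d)} (hP : IsConvolutedNoiseLaw ψ G P)
    {n : ℕ} (f : Fin n → 𝓢(Space d, ℝ)) (t : EuclideanSpace ℝ (Fin n)) :
    charFun (jointLaw f P) t = noiseCharFun ψ (adjConv G (∑ i, t i • f i : 𝓢(Space d, ℝ))) := by
  rw [charFun_apply, jointLaw, integral_map (measurable_toLp_eval f).aemeasurable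
    (by fun_prop : Continuous _).aestronglyMeasurable, ← hP.2]
  congr with ω
  rw [map_sum, mul_comm]
  congr 3
  simp [PiLp.inner_apply]

/-- The scaled Poisson noises converge to the Gaussian noise. -/
theorem tendsto_noiseCharFun [IsProbabilityMeasure r] (hr2 : Integrable (fun s => s ^ 2) r)
    (hsymm : r.map (fun s => -s) = r) (hG : Measurable G) (hGi : Integrable G)
    (f : 𝓢(Space d, ℝ)) :
    Tendsto (fun z => noiseCharFun (scaledPoissonChar r z) (adjConv G f)) atTop
      (𝓝 (noiseCharFun (gaussianChar (∫ s, s ^ 2 ∂r)) (adjConv G f))) := by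
  simp_rw [noiseCharFun_scaledPoissonChar hsymm, noiseCharFun_gaussianChar]
  have h : Tendsto (fun z => ∫ u, poissonExponent r z (adjConv G f u)) atTop
      (𝓝 (∫ u, (∫ s, s ^ 2 ∂r) / 2 * adjConv G f u ^ 2)) := by
    refine tendsto_integral_filter_of_dominated_convergence
      (fun u => (∫ s, s ^ 2 ∂r) / 2 * adjConv G f u ^ 2)
      (Eventually.of_forall fun z => ((measurable_poissonExponent z).comp
        (measurable_adjConv hG f.continuous.measurable)).aestronglyMeasurable) ?_
      ((integrable_sq_adjConv hG hGi f).const_mul _)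
      (ae_of_all _ fun u => tendsto_poissonExponent hr2 _)
    filter_upwards [eventually_gt_atTop 0] with z hz
    refine ae_of_all _ fun u => ?_
    rw [Real.norm_of_nonneg (poissonExponent_nonneg hz.le _)]
    exact poissonExponent_le_sq hr2 hz _
  exact (Complex.continuous_ofReal.tendsto _).comp ((Real.continuous_exp.tendsto _).comp h.neg)

/-- The convoluted Poisson noises converge in law to the Gaussian one: the characteristic functions
of the joint laws converge pointwise, and Lévy's continuity theorem applies. -/
theorem convergesInLaw_free [IsProbabilityMeasure r] (hr2 : Integrable (fun s => s ^ 2) r)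
    (hsymm : r.map (fun s => -s) = r) (hG : Measurable G) (hGi : Integrable G)
    {P : ℝ → Measure (TempDist d)}
    (hP : ∀ z : ℝ, 1 ≤ z → IsConvolutedNoiseLaw (scaledPoissonChar r z) G (P z))
    {Pσ : Measure (TempDist d)}
    (hPσ : IsConvolutedNoiseLaw (gaussianChar (∫ s, s ^ 2 ∂r)) G Pσ) : ConvergesInLaw P Pσ := by
  intro n f φ
  refine tendsto_of_seq_tendsto fun u hu => ?_
  -- the laws `P z` are only specified for `z ≥ 1`
  let w (k : ℕ) : ℝ := max 1 (u k)
  have hw1 (k : ℕ) : 1 ≤ w k := le_max_left _ _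
  have hw : Tendsto w atTop atTop := tendsto_atTop_mono (fun k => le_max_right _ _) hu
  have hprob {ψ : ℝ → ℂ} {Q : Measure (TempDist d)} (hQ : IsConvolutedNoiseLaw ψ G Q) :
      IsProbabilityMeasure (jointLaw f Q) := by
    have := hQ.1
    exact Measure.isProbabilityMeasure_map (measurable_toLp_eval f).aemeasurable
  let μ (k : ℕ) : ProbabilityMeasure (EuclideanSpace ℝ (Fin n)) :=
    ⟨jointLaw f (P (w k)), hprob (hP _ (hw1 k))⟩
  let μσ : ProbabilityMeasure (EuclideanSpace ℝ (Fin n)) := ⟨jointLaw f Pσ, hprob hPσ⟩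
  have hμ : Tendsto μ atTop (𝓝 μσ) := by
    rw [ProbabilityMeasure.tendsto_iff_tendsto_charFun]
    intro t
    change Tendsto (fun k => charFun (jointLaw f (P (w k))) t) atTop
      (𝓝 (charFun (jointLaw f Pσ) t))
    rw [charFun_jointLaw hPσ]
    simp_rw [fun k => charFun_jointLaw (hP (w k) (hw1 k)) f t]
    exact (tendsto_noiseCharFun hr2 hsymm hG hGi _).comp hw
  rw [ProbabilityMeasure.tendsto_iff_forall_integral_tendsto] at hμ
  have h1 := hμ (φ.compContinuous ⟨WithLp.ofLp, by fun_prop⟩)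
  have e (Q : Measure (TempDist d)) :
      ∫ x, (φ.compContinuous ⟨WithLp.ofLp, by fun_prop⟩) x ∂(jointLaw f Q) =
        ∫ ω, φ (fun i => ω (f i)) ∂Q := by
    rw [jointLaw, integral_map (measurable_toLp_eval f).aemeasurable
      (BoundedContinuousFunction.continuous _).aestronglyMeasurable]
    rfl
  change Tendsto (fun k => ∫ x, (φ.compContinuous ⟨WithLp.ofLp, by fun_prop⟩) x
    ∂(jointLaw f (P (w k)))) atTop (𝓝 (∫ x, (φ.compContinuous ⟨WithLp.ofLp, by fun_prop⟩) x
    ∂(jointLaw f Pσ))) at h1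
  simp_rw [e] at h1
  refine h1.congr' ?_
  filter_upwards [hu.eventually_ge_atTop 1] with k hk
  simp only [w, Function.comp_apply]
  rw [max_eq_right hk]

end Free

end

/-! ### Triviality of the continuum limit -/

section

variable {d : ℕ} {r : Measure ℝ} {G : Space d → ℝ} {P : Measure (TempDist d)} {z : ℝ}
  {Λ : Set (Space d)}

/-- The potential of the convoluted Poisson noise: it is defined almost everywhere by a function,
it is measurable, and its first absolute moment is controlled by the two-point functions. -/
theorem IsConvolutedNoiseLaw.potential_bound [IsProbabilityMeasure r]
    (hr : Integrable (fun s => |s|) r) (hsymm : r.map (fun s => -s) = r) (hz : 0 < z)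
    (hG : Measurable G) (hGi : Integrable G) (ν : ComplexMeasure ℝ) (hΛ : IsCompact Λ)
    (hP : IsConvolutedNoiseLaw (scaledPoissonChar r z) G P) :
    (∀ᵐ ω ∂P, ∃ h : Space d → ℝ, IsGivenBy ω h) ∧ AEMeasurable (potential (trigDensity ν) Λ) P ∧
      ∫⁻ ω, ‖potential (trigDensity ν) Λ ω‖ₑ ∂P ≤
        ENNReal.ofReal (∫ α, Real.sqrt (pairAverage r G Λ z α) ∂(interactionVariation ν)) := by
  have := hP.1
  obtain ⟨h, hm, hgiven, hpair⟩ := hP.exists_path hr hsymm hz hG hGi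
  have hV : potential (trigDensity ν) Λ =ᵐ[P] fun ω => ∫ x in Λ, trigDensity ν (h (x, ω)) := by
    filter_upwards [hgiven] with ω hω
    exact potential_eq hω _ _
  have hmv : Measurable fun q : TempDist d × Space d => trigDensity ν (h (q.2, q.1)) :=
    (measurable_trigDensity ν).comp (by fun_prop)
  refine ⟨hgiven.mono fun ω hω => ⟨_, hω⟩, ⟨_, (hmv.stronglyMeasurable.integral_prod_right'
    (ν := volume.restrict Λ)).measurable, hV⟩, ?_⟩
  rw [lintegral_congr_ae (hV.mono fun ω hω => by rw [hω])]
  exact lintegral_enorm_integral_trigDensity_le hG ν hz.le hΛ hm hpair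

/-- For bounded functions, the `L²`-norm is controlled by the `L¹`-norm. -/
theorem eLpNorm_two_le_of_bound {Ω : Type*} [MeasurableSpace Ω] {P : Measure Ω} {V : Ω → ℝ} {M : ℝ}
    (hM : ∀ ω, |V ω| ≤ M) :
    eLpNorm V 2 P ≤ (ENNReal.ofReal M * ∫⁻ ω, ‖V ω‖ₑ ∂P) ^ (1 / 2 : ℝ) := by
  rw [eLpNorm_eq_lintegral_rpow_enorm_toReal two_ne_zero ENNReal.ofNat_ne_top]
  simp only [ENNReal.toReal_ofNat, ENNReal.rpow_ofNat]
  refine ENNReal.rpow_le_rpow ?_ (by norm_num)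
  rw [← lintegral_const_mul' _ _ ENNReal.ofReal_ne_top]
  refine lintegral_mono fun ω => ?_
  rw [sq]
  refine mul_le_mul_left ?_ _
  rw [Real.enorm_eq_ofReal_abs]
  exact ENNReal.ofReal_le_ofReal (hM ω)

theorem integral_sq_pos_of_singleton_zero [IsProbabilityMeasure r]
    (hr2 : Integrable (fun s => s ^ 2) r) (hr0 : r {0} = 0) : 0 < ∫ s, s ^ 2 ∂r := by
  rw [integral_pos_iff_support_of_nonneg (fun s => sq_nonneg s) hr2]
  have h : Function.support (fun s : ℝ => s ^ 2) = {0}ᶜ := by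
    ext s
    simp
  rw [h, prob_compl_eq_one_sub (measurableSet_singleton 0), hr0]
  simp

end

theorem theorem7p2 {d : ℕ}
    -- the law `r` of the charges: compact support, no mass at zero, symmetric
    (r : Measure ℝ) [IsProbabilityMeasure r] (c : ℝ) (hc : 0 < c)
    (hrc : r (Set.Icc (-c) c)ᶜ = 0) (hr0 : r {0} = 0)
    (hrsymm : r.map (fun s => -s) = r)
    -- the kernel
    (G : Space d → ℝ) (hG1 : MemLp G 1) (hG2 : ¬ MemLp G 2)
    -- the interaction measure
    (ν : ComplexMeasure ℝ) (hν0 : ν {0} = 0)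
    (hνsymm : ∀ A : Set ℝ, MeasurableSet A →
      ν A = (starRingEnd ℂ) (ν ((fun α => -α) ⁻¹' A)))
    -- the infra-red cut-off and the inverse temperature
    (Λ : Set (Space d)) (hΛ : IsCompact Λ) (β : ℝ) (hβ : 0 < β)
    -- the laws of the convoluted Poisson noises `X^z`
    (P : ℝ → Measure (TempDist d))
    (hP : ∀ z : ℝ, 1 ≤ z → IsConvolutedNoiseLaw (scaledPoissonChar r z) G (P z))
    -- the law of the Gaussian convoluted noise `X^σ`, where `σ² = ∫ s² dr(s)`
    (Pσ : Measure (TempDist d))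
    (hPσ : IsConvolutedNoiseLaw (gaussianChar (∫ s, s ^ 2 ∂r)) G Pσ) :
    -- the potential and the interacting model are well defined
    (∀ z : ℝ, 1 ≤ z →
      (∀ᵐ ω ∂(P z), ∃ h : Space d → ℝ, IsGivenBy ω h) ∧
      AEMeasurable (potential (trigDensity ν) Λ) (P z) ∧
      Integrable (fun ω => Real.exp (-β * potential (trigDensity ν) Λ ω)) (P z) ∧
      0 < partitionFunction β (potential (trigDensity ν) Λ) (P z) ∧
      IsProbabilityMeasure (interactingLaw β (potential (trigDensity ν) Λ) (P z))) ∧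
    -- the potential vanishes in `L²` in the continuum limit
    Tendsto (fun z : ℝ => eLpNorm (potential (trigDensity ν) Λ) 2 (P z)) atTop (𝓝 0) ∧
    -- the interacting convoluted Poisson noise converges in law to the Gaussian one
    ConvergesInLaw
      (fun z => interactingLaw β (potential (trigDensity ν) Λ) (P z)) Pσ := by
  have hrb : ∀ᵐ s ∂r, |s| ≤ c := by
    filter_upwards [show ∀ᵐ s ∂r, s ∈ Set.Icc (-c) c from hrc] with s hs
    exact abs_le.2 hs
  have hr : Integrable (fun s => |s|) r :=
    Integrable.of_bound (by fun_prop : Measurable _).aestronglyMeasurable c (by simpa using hrb)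
  have hr2 : Integrable (fun s => s ^ 2) r :=
    Integrable.of_bound (by fun_prop : Measurable _).aestronglyMeasurable (c ^ 2) (by
      filter_upwards [hrb] with s hs
      rw [Real.norm_of_nonneg (sq_nonneg s), ← sq_abs]
      gcongr)
  -- charges do not vanish, so that the Gaussian limit is not degenerate
  have hσ := integral_sq_pos_of_singleton_zero hr2 hr0
  -- the kernel only matters up to null sets, so it may be replaced by a measurable one
  obtain ⟨G', hG'm, hGG'⟩ := hG1.1
  have hlaw {ψ : ℝ → ℂ} {Q : Measure (TempDist d)} (hQ : IsConvolutedNoiseLaw ψ G Q) :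
      IsConvolutedNoiseLaw ψ G' Q := ⟨hQ.1, fun f => by rw [hQ.2 f, adjConv_congr hGG']⟩
  have hGm : Measurable G' := hG'm.measurable
  have hGi : Integrable G' := (memLp_one_iff_integrable.1 hG1).congr hGG'
  have hG2' : ¬ MemLp G' 2 := fun h => hG2 ((memLp_congr_ae hGG').2 h)
  set V := potential (trigDensity ν) Λ with hVdef
  set M : ℝ := (interactionVariation ν).real Set.univ * volume.real Λ
  have hM : ∀ ω, |V ω| ≤ M := abs_potential_le hΛ ν
  let η (z : ℝ) : ℝ := ∫ α, Real.sqrt (pairAverage r G' Λ z α) ∂(interactionVariation ν)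
  have hη : Tendsto η atTop (𝓝 0) := tendsto_integral_sqrt_pairAverage hr hr2 hσ hGm hGi hG2' hΛ
    (interactionVariation_singleton_zero ν hν0)
  have hη0 (z : ℝ) : 0 ≤ η z := integral_nonneg fun _ => Real.sqrt_nonneg _
  have hz (z : ℝ) (h : 1 ≤ z) := (hlaw (hP z h)).potential_bound hr hrsymm
    (zero_lt_one.trans_le h) hGm hGi ν hΛ
  refine ⟨fun z h => ?_, ?_, fun n f φ => ?_⟩
  · have := (hP z h).1
    obtain ⟨h1, h2, -⟩ := hz z h
    exact ⟨h1, h2, integrable_exp_of_bound h2 hM hβ, partitionFunction_pos h2 hM hβ,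
      isProbabilityMeasure_interactingLaw h2 hM hβ⟩
  · have hlim : Tendsto (fun z => (ENNReal.ofReal M * ENNReal.ofReal (η z)) ^ (1 / 2 : ℝ)) atTop
        (𝓝 0) := by
      have h1 := ENNReal.Tendsto.const_mul (ENNReal.tendsto_ofReal hη)
        (Or.inr (ENNReal.ofReal_ne_top (r := M)))
      have h2 := (ENNReal.continuous_rpow_const (y := (1 / 2 : ℝ))).tendsto _ |>.comp h1
      simpa [Function.comp_def] using h2
    refine tendsto_of_tendsto_of_tendsto_of_le_of_le' tendsto_const_nhds hlim
      (Eventually.of_forall fun _ => zero_le) ?_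
    filter_upwards [eventually_ge_atTop 1] with z h
    refine (eLpNorm_two_le_of_bound hM).trans (ENNReal.rpow_le_rpow ?_ (by norm_num))
    exact mul_le_mul_right (hz z h).2.2 _
  · have hfree := convergesInLaw_free hr2 hrsymm hGm hGi (fun z h => hlaw (hP z h)) (hlaw hPσ) n f φ
    have hφm : Measurable fun ω : TempDist d => φ fun i => ω (f i) :=
      φ.continuous.measurable.comp (measurable_pi_lambda _ fun i => measurable_eval (f i))
    have hdiff : Tendsto (fun z => ∫ ω, φ (fun i => ω (f i)) ∂(interactingLaw β V (P z)) -
        ∫ ω, φ (fun i => ω (f i)) ∂(P z)) atTop (𝓝 0) := by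
      have hlim : Tendsto (fun z => 2 * ‖φ‖ * β * Real.exp (2 * (β * M)) * η z) atTop (𝓝 0) := by
        simpa using hη.const_mul (2 * ‖φ‖ * β * Real.exp (2 * (β * M)))
      refine squeeze_zero_norm' ?_ hlim
      filter_upwards [eventually_ge_atTop 1] with z h
      have := (hP z h).1
      obtain ⟨-, h2, h3⟩ := hz z h
      refine (abs_integral_interactingLaw_sub_le h2 hM hβ hφm
        fun ω => φ.norm_coe_le_norm _).trans ?_
      have h4 : ∫ ω, |V ω| ∂(P z) ≤ η z := by
        rw [← ENNReal.ofReal_le_ofReal_iff (hη0 z)]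
        refine le_trans (le_of_eq ?_) h3
        rw [ofReal_integral_eq_lintegral_ofReal
          (Integrable.of_bound h2.abs.aestronglyMeasurable M (by simpa using ae_of_all _ hM))
          (ae_of_all _ fun _ => abs_nonneg _)]
        simp_rw [Real.enorm_eq_ofReal_abs]
      exact mul_le_mul_of_nonneg_left h4 (by positivity)
    simpa using hdiff.add hfree
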